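/- Let $n\ge 0$ and $m\ge 1$ be integers, $X=(x_1,\dots,x_n)$, and order the monomials of $\mathbb C[X]$ lexicographically with $x_1>\cdots>x_n$. Write $P(X^m)=P(x_1^m,\dots,x_n^m)$ and, for a set $\mathcal S$ of polynomials, $\mathcal S^m=\{P(X^m): P\in\mathcal S\}$. For $\nu\in\mathbb N^n$ let $c(\nu)$ be the composition obtained by deleting the zero entries of $\nu$. A Gröbner basis of an ideal $I$ is a (possibly infinite) subset of $I$ whose leading terms generate the ideal of leading terms of $I$. Let $G_{n,m}$ be the group of complex $n\times n$ matrices with exactly one nonzero entry in each row and each column, the nonzero entries being $m$-th roots of unity. It acts linearly on $\mathbb C[X]$ by the quasi-symmetrizing action $$g\bullet A^K=w(g)^{\delta(K)}\,\bigl((A\cdot{}^t|g|)_<\bigr)^K,$$ where $A$ is a subset of the variables listed in increasing order, $K$ is a vector of positive integers, $w(g)$ is the product of the nonzero entries of $g$, $|g|$ is the matrix of absolute values, $(\cdot)_<$ means sorting the variables increasingly, and $\delta(K)=0$ if $m$ divides every entry of $K$, $\delta(K)=1$ otherwise. Let $QInv_{n,m}$ be the space of polynomials $P$ with $g\bullet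 P=P$ for all $g\in G_{n,m}$, and let $\mathcal J_{n,m}=\langle QInv_{n,m}^+\rangle$ be the ideal of $\mathbb C[X]$ generated by the $P\in QInv_{n,m}$ without constant term. Call $\varepsilon\in\mathbb N^n$ transdiagonal if $\varepsilon_1+\cdots+\varepsilon_k\ge k$ for some $1\le k\le n$ (that is, the lattice path from $(0,0)$ that makes $\varepsilon_k$ East steps at height $k-1$ for each $k$ goes strictly below the diagonal $y=x$). The Aval–Bergeron–Bergeron polynomials $G_\varepsilon$, $\varepsilon\in\mathbb N^n$, are defined recursively as follows. If $\varepsilon=\alpha 0\cdots0$ with $\alpha$ a composition, then $G_\varepsilon=F_\alpha$ is the fundamental quasi-symmetric polynomial, the sum of the monomials $X^\nu$ such that $c(\nu)$ refines $\alpha$. Otherwise write $\varepsilon=w\,0\,a\,\beta\,0\cdots0$ with $a>0$ and $\beta$ a (possibly empty) composition, let $k$ be the position of the displayed $0$ before $a$, and put $$G_{w0a\beta0\cdots0}=G_{wa\beta0\cdots0}-x_k\,G_{w(a-1)\beta0\cdots0},$$ all index vectors having length $n$. Let $\mathcal G=\{G_\varepsilon:\varepsilon\in\mathbb N^n\text{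 transdiagonal}\}$. Then $\mathcal G^m=\{G_\varepsilon(X^m)\}$ is a Gröbner basis of $\mathcal J_{n,m}$. Moreover, for every Gröbner basis $\mathcal S$ of $\mathcal J_{n,1}$, the set $\mathcal S^m$ is a Gröbner basis of $\mathcal J_{n,m}$. -/

import Mathlib

open MvPolynomial

namespace QuasiInv

/-- The composition `c(ν)`: the list of the nonzero entries of `ν`, in order. -/
def comp {n : ℕ} (ν : Fin n → ℕ) : List ℕ :=
  (List.ofFn ν).filter (fun a => a ≠ 0)

/-- The generalized symmetric group `G_{n,m} = S_n ≀ ℤ_m`: the complex `n × n` matrices with exactly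
one nonzero entry in each row and each column, the nonzero entries being `m`-th roots of unity. -/
def genSymmGroup (n m : ℕ) : Set (Matrix (Fin n) (Fin n) ℂ) :=
  {g | (∀ i, ∃! j, g i j ≠ 0) ∧ (∀ j, ∃! i, g i j ≠ 0) ∧ ∀ i j, g i j ≠ 0 → g i j ^ m = 1}

open Classical in
/-- The weight `w(g)`: the product of the nonzero entries of `g`. -/
noncomputable def weight {n : ℕ} (g : Matrix (Fin n) (Fin n) ℂ) : ℂ :=
  ∏ i, ∏ j, if g i j ≠ 0 then g i j else 1

open Classical in
/-- The exponent `c(K)`, which is `0` if all parts of `K` are divisible by `m`, and `1` otherwise. -/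
noncomputable def weightExp (m : ℕ) (K : List ℕ) : ℕ :=
  if ∀ k ∈ K, m ∣ k then 0 else 1

open Classical in
/-- The set of variables occurring in `A.ᵗ|g|`, for a set `A` of variables: as `X.ᵗ|g|` is the row
vector with `i`-th entry `∑ j, |g i j| x_j`, the variable `x_i` is sent to the `x_j` with
`g i j ≠ 0`. -/
noncomputable def imageAlphabet {n : ℕ} (g : Matrix (Fin n) (Fin n) ℂ) (A : Finset (Fin n)) :
    Finset (Fin n) :=
  Finset.univ.filter fun j => ∃ i ∈ A, g i j ≠ 0

/-- The exponent vector of the monomial `(B)_<^K`: the variables of `B`, in increasing order, are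
raised to the powers `k_1, k_2, …`. -/
noncomputable def orderedExponent {n : ℕ} (B : Finset (Fin n)) (K : List ℕ) : Fin n →₀ ℕ :=
  Finsupp.equivFunOnFinite.symm fun j =>
    if j ∈ B then K.getD (B.filter (· < j)).card 0 else 0

/-- The quasi-symmetrizing action: the linear operator `P ↦ g • P` on `ℂ[X]` with
`g • A^K = w(g)^{c(K)} ((A.ᵗ|g|)_<)^K`. A monomial `X^ν` is `A^K` with `A` the support of `ν` and
`K = c(ν)`. -/
noncomputable def quasiAct {n : ℕ} (m : ℕ) (g : Matrix (Fin n) (Fin n) ℂ)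
    (P : MvPolynomial (Fin n) ℂ) : MvPolynomial (Fin n) ℂ :=
  ∑ ν ∈ P.support,
    monomial (orderedExponent (imageAlphabet g ν.support) (comp ν))
      (P.coeff ν * weight g ^ weightExp m (comp ν))

/-- The quasi-invariant polynomials `QInv_{n,m}`. -/
def QInv (n m : ℕ) : Set (MvPolynomial (Fin n) ℂ) :=
  {P | ∀ g ∈ genSymmGroup n m, quasiAct m g P = P}

/-- The ideal `J_{n,m}` generated by the quasi-invariant polynomials without constant term. -/
noncomputable def quasiIdeal (n m : ℕ) : Ideal (MvPolynomial (Fin n) ℂ) :=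
  Ideal.span {P | P ∈ QInv n m ∧ constantCoeff P = 0}

/-- `S` is a Gröbner basis of `I`: `S ⊆ I`, and the leading terms of the elements of `S` generate
the ideal of the leading terms of `I`. -/
def IsGroebnerBasis {σ : Type*} {k : Type*} [Field k] (ord : MonomialOrder σ)
    (S : Set (MvPolynomial σ k)) (I : Ideal (MvPolynomial σ k)) : Prop :=
  S ⊆ (I : Set (MvPolynomial σ k)) ∧
    Ideal.span (ord.leadingTerm '' S) =
      Ideal.span (ord.leadingTerm '' (I : Set (MvPolynomial σ k)))

/-- `ν` is a Dyck vector: its path `π(ν)`, with East steps `ν_1, …, ν_n` at the heights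
`0, …, n - 1`, stays weakly above the diagonal `y = x`. It suffices to test the right end
`(ν_1 + ⋯ + ν_{k+1}, k)` of each horizontal segment. -/
def IsDyck {n : ℕ} (ν : Fin n → ℕ) : Prop :=
  ∀ k : Fin n, ∑ i ∈ Finset.Iic k, ν i ≤ (k : ℕ)

/-- Transdiagonal vectors: those that are not Dyck. -/
def IsTransdiagonal {n : ℕ} (ν : Fin n → ℕ) : Prop :=
  ¬ IsDyck ν

/-- The composition `β` refines the composition `α`: it is obtained by replacing each part of `α`
by a composition of that part. -/
def Refines (β α : List ℕ) : Prop :=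
  ∃ L : List (List ℕ), L.flatten = β ∧ L.map List.sum = α

open Classical in
/-- The fundamental quasi-symmetric polynomial `F_α = ∑ M_β` in `n` variables, the sum being over
the refinements `β` of the composition `α`; that is, the sum of the monomials `X^ν` for which
`c(ν)` refines `α`. -/
noncomputable def fundamental (n : ℕ) (α : List ℕ) : MvPolynomial (Fin n) ℂ :=
  ∑ ν ∈ (Finset.finsuppAntidiag (Finset.univ : Finset (Fin n)) α.sum).filter
      (fun ν : Fin n →₀ ℕ => Refines (comp ν) α), monomial ν 1

/-- The positions `k` with `ε_k = 0` and `ε_{k+1} ≠ 0`. -/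
def ascents {n : ℕ} (ε : Fin n → ℕ) : Finset (Fin n) :=
  Finset.univ.filter fun k => ε k = 0 ∧ ∃ h : (k : ℕ) + 1 < n, ε ⟨k + 1, h⟩ ≠ 0

/-- The vector obtained by erasing the entry at `k` and appending a zero at the end. -/
def eraseEntry {n : ℕ} (ε : Fin n → ℕ) (k : Fin n) : Fin n → ℕ := fun i =>
  if i < k then ε i else if h : (i : ℕ) + 1 < n then ε ⟨i + 1, h⟩ else 0

/-- The vector obtained by lowering the entry at `k` by one. -/
def lowerEntry {n : ℕ} (ε : Fin n → ℕ) (k : Fin n) : Fin n → ℕ :=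
  Function.update ε k (ε k - 1)

/-- Termination measure. -/
def moment {n : ℕ} (ε : Fin n → ℕ) : ℕ := ∑ i : Fin n, (i : ℕ) * ε i

theorem moment_eraseEntry_lt {n : ℕ} (ε : Fin n → ℕ) (k : Fin n) (hk : k ∈ ascents ε) :
    moment (eraseEntry ε k) < moment ε := by
  cases n with
  | zero => exact k.elim0
  | succ N =>
    obtain ⟨h0, hlt, hne⟩ := (Finset.mem_filter.1 hk).2
    have hkN : (k : ℕ) < N := by omega
    have hval : ∀ i : Fin N, eraseEntry ε k i.castSucc = ε (k.succAbove i) := by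
      intro i
      unfold eraseEntry Fin.succAbove
      split_ifs with h1 h2
      · rfl
      · rfl
      · exact absurd (Nat.succ_lt_succ i.2) h2
    have hlast : eraseEntry ε k (Fin.last N) = 0 := by
      unfold eraseEntry
      rw [if_neg (by simp [Fin.lt_def]; omega), dif_neg (by simp)]
    unfold moment
    rw [Fin.sum_univ_castSucc, Fin.sum_univ_succAbove _ k, hlast, h0, mul_zero, mul_zero,
      add_zero, zero_add]
    refine Finset.sum_lt_sum (fun i _ => ?_) ⟨⟨k, hkN⟩, Finset.mem_univ _, ?_⟩
    · rw [hval]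
      refine Nat.mul_le_mul_right _ ?_
      unfold Fin.succAbove
      split_ifs <;> simp
    · have hs : k.succAbove ⟨k, hkN⟩ = ⟨k + 1, hlt⟩ := by
        unfold Fin.succAbove
        rw [if_neg (by simp)]
        rfl
      rw [hval, hs]
      exact Nat.mul_lt_mul_of_pos_right (by simp) (Nat.pos_of_ne_zero hne)

theorem moment_lowerEntry_le {n : ℕ} (ε : Fin n → ℕ) (k : Fin n) :
    moment (lowerEntry ε k) ≤ moment ε := by
  refine Finset.sum_le_sum fun i _ => Nat.mul_le_mul_left _ ?_
  unfold lowerEntry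
  by_cases h : i = k
  · subst h; simp
  · simp [h]

/-- The polynomials `G_ε` of Aval, Bergeron and Bergeron. If no zero entry of `ε` is followed by a
nonzero entry, so `ε = α 0 ⋯ 0` with `α` a composition, then `G_ε = F_α`. Otherwise write
`ε = w 0 a β 0 ⋯ 0` with `a > 0` and `β` a composition (possibly empty), where the displayed zero
before `a` is at position `k`; then
`G_ε = G_{w a β 0 ⋯ 0} - x_k G_{w (a-1) β 0 ⋯ 0}`. -/
noncomputable def abbG {n : ℕ} (ε : Fin n → ℕ) : MvPolynomial (Fin n) ℂ :=
  if h : (ascents ε).Nonempty then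
    abbG (eraseEntry ε ((ascents ε).max' h)) -
      X ((ascents ε).max' h) *
        abbG (lowerEntry (eraseEntry ε ((ascents ε).max' h)) ((ascents ε).max' h))
  else fundamental n (comp ε)
termination_by moment ε
decreasing_by
  · exact moment_eraseEntry_lt ε _ (Finset.max'_mem _ h)
  · exact lt_of_le_of_lt (moment_lowerEntry_le _ _) (moment_eraseEntry_lt ε _ (Finset.max'_mem _ h))

/-- The family `𝒢` of the polynomials `G_ε`, for `ε` transdiagonal. -/
def abbFamily (n : ℕ) : Set (MvPolynomial (Fin n) ℂ) :=
  {P | ∃ ε : Fin n → ℕ, IsTransdiagonal ε ∧ P = abbG ε}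

/-- `𝒮^m`, the set of the `P(x_1^m, …, x_n^m)` with `P ∈ 𝒮`. -/
def powSet {n : ℕ} (m : ℕ) (S : Set (MvPolynomial (Fin n) ℂ)) : Set (MvPolynomial (Fin n) ℂ) :=
  (fun P => expand m P) '' S

end QuasiInv

namespace QuasiInv

variable {n : ℕ}

/-! The general case reduces to `m = 1`. Permutation matrices force a quasi-invariant to be
quasi-symmetric, and a diagonal matrix with one nontrivial root of unity kills every monomial having
an exponent not divisible by `m`. Hence `QInv n m` consists of the `Q(X^m)` with `Q` quasi-symmetric
(`QInv_eq_image`), and `quasiIdeal n m` is the extension of `qsymIdeal n` along `expand m`. The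
polynomial ring is free over the polynomials in `X^m`, with basis the `X^r`, `r i < m`. The
components of an element of the extended ideal lie in the original ideal, and one of them carries
its leading term, so Gröbner bases pass through `expand m` (`IsGroebnerBasis.image_expand`).

For `m = 1`, the polynomial `G_ε` has leading monomial `X^ε` with coefficient `1`
(`abbG_triangular`), so nonzero elements of the linear span of `𝒢` have transdiagonal leading
exponents. It remains to see that this span is the whole ideal. The recursion stays among
transdiagonal vectors and ends at fundamental polynomials of positive degree, so `𝒢` lies in the
ideal.

Conversely, take `P * q` with `q` quasi-symmetric without constant term. Rewriting with `𝒢` and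
reversing the variables expresses `P` through products `X^η q'`, with `q'` quasi-symmetric and `η` a
reversed Dyck vector (`mem_revDyckSpan`). Then `q' * q` is a combination of polynomials `F_α` of
positive degree, and it suffices to treat `X^η F_α`. In degree at least `n` every vector is
transdiagonal, and triangularity suffices. In lower degree the recursion, read backwards as a
formula for `x_k G_ε`, applies one variable at a time; the bound on `η` guarantees that the vectors
do not overflow (`monomial_mul_abbG_mem_transSpan`). -/

/-! ### Exponent vectors and their compositions. -/

theorem comp_eq_map_filter (ν : Fin n → ℕ) :
    comp ν = ((List.finRange n).filter (fun i => ν i ≠ 0)).map ν := by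
  rw [comp, List.ofFn_eq_map, List.filter_map]
  rfl

theorem filter_finRange_eq_sort (ν : Fin n →₀ ℕ) :
    (List.finRange n).filter (fun i => ν i ≠ 0) = ν.support.sort := by
  apply List.Perm.eq_of_pairwise (le := (· ≤ ·))
  · intro a b _ _ h1 h2; exact le_antisymm h1 h2
  · exact ((List.pairwise_lt_finRange n).imp le_of_lt).filter _
  · exact ν.support.pairwise_sort (· ≤ ·)
  · rw [List.perm_ext_iff_of_nodup ((List.nodup_finRange n).filter _) (Finset.sort_nodup _ _)]
    intro a
    simp

theorem comp_eq_map_sort (ν : Fin n →₀ ℕ) : comp ν = (ν.support.sort).map ν := by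
  rw [comp_eq_map_filter, filter_finRange_eq_sort]

theorem comp_mapDomain {l : ℕ} (s : Fin l ↪o Fin n) (κ : Fin l →₀ ℕ) :
    comp (κ.mapDomain s) = comp κ := by
  have h : (κ.mapDomain s).support.sort = (κ.support.sort).map s := by
    apply List.Perm.eq_of_pairwise (le := (· ≤ ·))
    · intro a b _ _ h1 h2; exact le_antisymm h1 h2
    · exact Finset.pairwise_sort _ _
    · rw [List.pairwise_map]
      exact (Finset.pairwise_sort κ.support (· ≤ ·)).imp (fun h => s.monotone h)
    · rw [List.perm_ext_iff_of_nodup (Finset.sort_nodup _ _)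
        ((Finset.sort_nodup _ _).map s.injective)]
      intro a
      rw [Finset.mem_sort, Finsupp.mapDomain_support_of_injective s.injective]
      simp
  rw [comp_eq_map_sort, comp_eq_map_sort, h, List.map_map]
  refine List.map_congr_left fun a _ => ?_
  simp [Finsupp.mapDomain_apply s.injective]

/-- The vector of the entries of a list. -/
noncomputable def listVec (l : List ℕ) : Fin l.length →₀ ℕ := Finsupp.equivFunOnFinite.symm l.get

theorem mapDomain_listVec_comp (ν : Fin n →₀ ℕ) (hlen : ν.support.card = (comp ν).length) :
    (listVec (comp ν)).mapDomain (ν.support.orderEmbOfFin hlen) = ν := by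
  ext i
  by_cases hi : i ∈ Set.range (ν.support.orderEmbOfFin hlen)
  · obtain ⟨j, rfl⟩ := hi
    rw [Finsupp.mapDomain_apply (ν.support.orderEmbOfFin hlen).injective]
    simp [listVec, Finset.orderEmbOfFin_apply, comp_eq_map_sort]
  · rw [Finsupp.mapDomain_of_notMem_range _ _ hi]
    symm
    simpa [Finset.range_orderEmbOfFin] using hi

theorem card_support_eq_length_comp (ν : Fin n →₀ ℕ) : ν.support.card = (comp ν).length := by
  simp [comp_eq_map_sort]

/-- Vectors with the same composition are thus placements of one list along different order
embeddings. -/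
theorem exists_eq_mapDomain_listVec (ν : Fin n →₀ ℕ) {l : List ℕ} (hl : comp ν = l) :
    ∃ s : Fin l.length ↪o Fin n, ν = (listVec l).mapDomain s := by
  subst hl
  exact ⟨_, (mapDomain_listVec_comp ν (card_support_eq_length_comp ν)).symm⟩

theorem comp_sum (ν : Fin n → ℕ) : (comp ν).sum = ∑ i, ν i := by
  rw [comp, ← List.sum_ofFn]
  induction List.ofFn ν with
  | nil => rfl
  | cons a l ih => by_cases h : a = 0 <;> simp_all

theorem pos_of_mem_comp {ν : Fin n → ℕ} {a : ℕ} (h : a ∈ comp ν) : 0 < a := by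
  simpa [Nat.pos_iff_ne_zero] using (List.mem_filter.1 h).2

theorem comp_cons (a : ℕ) (u : Fin n → ℕ) :
    comp (Fin.cons a u : Fin (n + 1) → ℕ) = if a = 0 then comp u else a :: comp u := by
  unfold comp
  rw [List.ofFn_succ]
  simp only [Fin.cons_zero, Fin.cons_succ, List.filter_cons]
  split_ifs <;> simp_all

theorem comp_rev (ν : Fin n → ℕ) : comp (fun i => ν (Fin.rev i)) = (comp ν).reverse := by
  unfold comp
  rw [← List.filter_reverse]
  congr 1
  refine List.ext_getElem (by simp) fun i h1 h2 => ?_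
  simp only [List.getElem_ofFn, List.getElem_reverse, List.length_ofFn]
  congr 1
  ext
  simp
  omega

/-! ### Quasi-symmetric polynomials and their closure properties. -/

/-- Quasi-symmetric polynomials. -/
def IsQSym (P : MvPolynomial (Fin n) ℂ) : Prop :=
  ∀ ν μ : Fin n →₀ ℕ, comp ν = comp μ → coeff ν P = coeff μ P

/-- Since `killCompl` is an algebra homomorphism, this form of quasi-symmetry makes closure under
products immediate. -/
theorem isQSym_iff_killCompl {P : MvPolynomial (Fin n) ℂ} :
    IsQSym P ↔ ∀ (l : ℕ) (s t : Fin l ↪o Fin n),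
      killCompl s.injective P = killCompl t.injective P := by
  constructor
  · intro h l s t
    ext κ
    rw [coeff_killCompl, coeff_killCompl]
    exact h _ _ (by rw [comp_mapDomain, comp_mapDomain])
  · intro h ν μ hc
    obtain ⟨s, hs⟩ := exists_eq_mapDomain_listVec ν hc
    obtain ⟨t, ht⟩ := exists_eq_mapDomain_listVec μ rfl
    conv_lhs => rw [hs]
    conv_rhs => rw [ht]
    rw [← coeff_killCompl s.injective, ← coeff_killCompl t.injective, h]

theorem IsQSym.mul {P Q : MvPolynomial (Fin n) ℂ} (hP : IsQSym P) (hQ : IsQSym Q) :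
    IsQSym (P * Q) := by
  rw [isQSym_iff_killCompl] at *
  intro l s t
  rw [map_mul, map_mul, hP l s t, hQ l s t]

theorem IsQSym.one : IsQSym (1 : MvPolynomial (Fin n) ℂ) :=
  isQSym_iff_killCompl.2 fun l s t => by rw [map_one, map_one]

theorem IsQSym.sub {P Q : MvPolynomial (Fin n) ℂ} (hP : IsQSym P) (hQ : IsQSym Q) :
    IsQSym (P - Q) := by
  intro ν μ h
  rw [coeff_sub, coeff_sub, hP _ _ h, hQ _ _ h]

theorem IsQSym.smul {P : MvPolynomial (Fin n) ℂ} (c : ℂ) (hP : IsQSym P) : IsQSym (c • P) := by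
  intro ν μ h
  rw [coeff_smul, coeff_smul, hP _ _ h]

/-- Reversing the variables reverses every composition, and equal compositions have equal reversals.
-/
theorem IsQSym.rename_rev {P : MvPolynomial (Fin n) ℂ} (hP : IsQSym P) :
    IsQSym (rename Fin.rev P) := by
  have key : ∀ ν : Fin n →₀ ℕ, ∃ ν' : Fin n →₀ ℕ, comp ν' = (comp ν).reverse ∧
      coeff ν (rename Fin.rev P) = coeff ν' P := by
    intro ν
    refine ⟨ν.mapDomain Fin.rev, ?_, ?_⟩
    · rw [← comp_rev]
      congr 1
      ext i
      conv_lhs => rw [← Fin.rev_rev i]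
      rw [Finsupp.mapDomain_apply Fin.rev_injective]
    · conv_lhs => rw [show ν = (ν.mapDomain Fin.rev).mapDomain Fin.rev by
        rw [← Finsupp.mapDomain_comp, show (Fin.rev ∘ Fin.rev : Fin n → Fin n) = id by
          ext i; simp, Finsupp.mapDomain_id]]
      rw [coeff_rename_mapDomain _ Fin.rev_injective]
  intro ν μ h
  obtain ⟨ν', h1, h2⟩ := key ν
  obtain ⟨μ', h3, h4⟩ := key μ
  rw [h2, h4]
  exact hP _ _ (by rw [h1, h3, h])

/-! ### Refinement and fundamental quasi-symmetric polynomials. -/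

theorem Refines.sum_eq {β α : List ℕ} (h : Refines β α) : β.sum = α.sum := by
  obtain ⟨L, rfl, rfl⟩ := h
  rw [List.sum_flatten]

open Classical in
theorem coeff_fundamental (α : List ℕ) (ν : Fin n →₀ ℕ) :
    coeff ν (fundamental n α) = if Refines (comp ν) α then 1 else 0 := by
  unfold fundamental
  rw [coeff_sum]
  simp only [coeff_monomial]
  rw [Finset.sum_ite_eq']
  refine if_congr ?_ rfl rfl
  rw [Finset.mem_filter, and_iff_right_iff_imp]
  intro h
  rw [Finset.mem_finsuppAntidiag]
  refine ⟨?_, Finset.subset_univ _⟩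
  rw [← h.sum_eq, comp_sum]

theorem isQSym_fundamental (α : List ℕ) : IsQSym (fundamental n α) := by
  intro ν μ h
  rw [coeff_fundamental, coeff_fundamental, h]

theorem fundamental_isHomogeneous (α : List ℕ) : (fundamental n α).IsHomogeneous α.sum := by
  intro ν hν
  rw [coeff_fundamental] at hν
  have h : Refines (comp ν) α := by by_contra h; simp [h] at hν
  rw [← h.sum_eq, comp_sum]
  simp [Finsupp.weight_apply, Finsupp.sum_fintype]

theorem refines_nil_right {u : List ℕ} : Refines u [] ↔ u = [] := by
  constructor
  · rintro ⟨L, rfl, h⟩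
    rw [List.map_eq_nil_iff.1 h, List.flatten_nil]
  · rintro rfl
    exact ⟨[], rfl, rfl⟩

theorem refines_cons_right {u α : List ℕ} {a : ℕ} :
    Refines u (a :: α) ↔ ∃ l r, u = l ++ r ∧ l.sum = a ∧ Refines r α := by
  constructor
  · rintro ⟨L, rfl, h⟩
    obtain ⟨l, L, rfl, rfl, rfl⟩ := List.map_eq_cons_iff.1 h
    exact ⟨l, L.flatten, rfl, rfl, L, rfl, rfl⟩
  · rintro ⟨l, _, rfl, rfl, L, rfl, rfl⟩
    exact ⟨l :: L, rfl, rfl⟩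

/-- Positivity of `a` makes the first block nonempty, so that block contains `j`. -/
theorem refines_cons_iff {u α : List ℕ} {a j : ℕ} (ha : 0 < a) :
    Refines (j :: u) (a :: α) ↔ ∃ l r, u = l ++ r ∧ j + l.sum = a ∧ Refines r α := by
  rw [refines_cons_right]
  constructor
  · rintro ⟨l, r, h, rfl, hr⟩
    cases l with
    | nil => simp at ha
    | cons b l =>
      rw [List.cons_append, List.cons.injEq] at h
      exact ⟨l, r, h.2, by rw [h.1, List.sum_cons], hr⟩
  · rintro ⟨l, r, rfl, rfl, hr⟩
    exact ⟨j :: l, r, rfl, by rw [List.sum_cons], hr⟩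

theorem not_refines_of_lt {u α : List ℕ} {a j : ℕ} (ha : 0 < a) (h : a < j) :
    ¬ Refines (j :: u) (a :: α) := by
  rw [refines_cons_iff ha]
  rintro ⟨l, r, -, h', -⟩
  omega

theorem refines_cons_self {u α : List ℕ} {a : ℕ} (ha : 0 < a) (hu : ∀ x ∈ u, 0 < x) :
    Refines (a :: u) (a :: α) ↔ Refines u α := by
  rw [refines_cons_iff ha]
  constructor
  · rintro ⟨l, r, rfl, h, hr⟩
    cases l with
    | nil => exact hr
    | cons b l =>
      have := hu b (by simp)
      rw [List.sum_cons] at h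
      omega
  · intro h
    exact ⟨[], u, rfl, by simp, h⟩

theorem refines_succ_succ {u α : List ℕ} {a j : ℕ} (ha : 0 < a) :
    Refines ((j + 1) :: u) ((a + 1) :: α) ↔ Refines (j :: u) (a :: α) := by
  rw [refines_cons_iff ha, refines_cons_iff a.succ_pos]
  simp only [Nat.succ_eq_add_one, add_right_comm j 1, add_left_inj]

theorem refines_one_succ {u α : List ℕ} {a : ℕ} :
    Refines (1 :: u) ((a + 1) :: α) ↔ Refines u (a :: α) := by
  rw [refines_cons_iff a.succ_pos, refines_cons_right]
  simp only [add_comm 1, Nat.succ_eq_add_one, add_left_inj]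

/-! ### The recursion seen from the first entry, and the leading monomial of `G_ε`. -/

theorem succ_mem_ascents_cons {b : ℕ} {v : Fin n → ℕ} {k : Fin n} :
    k.succ ∈ ascents (Fin.cons b v : Fin (n + 1) → ℕ) ↔ k ∈ ascents v := by
  simp only [ascents, Finset.mem_filter, Finset.mem_univ, true_and, Fin.cons_succ, Fin.val_succ,
    add_lt_add_iff_right]
  rfl

theorem zero_mem_ascents_cons {b : ℕ} {v : Fin n → ℕ} :
    (0 : Fin (n + 1)) ∈ ascents (Fin.cons b v : Fin (n + 1) → ℕ) ↔
      b = 0 ∧ ∃ h : 0 < n, v ⟨0, h⟩ ≠ 0 := by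
  simp only [ascents, Finset.mem_filter, Finset.mem_univ, true_and, Fin.cons_zero]
  refine and_congr_right fun _ => ⟨?_, ?_⟩
  · rintro ⟨h, h'⟩
    exact ⟨by simpa using h, h'⟩
  · rintro ⟨h, h'⟩
    exact ⟨by simpa using h, h'⟩

theorem eraseEntry_cons_succ (b : ℕ) (v : Fin n → ℕ) (k : Fin n) :
    eraseEntry (Fin.cons b v : Fin (n + 1) → ℕ) k.succ = Fin.cons b (eraseEntry v k) := by
  ext i
  refine Fin.cases ?_ (fun i => ?_) i
  · simp [eraseEntry]
  · simp only [eraseEntry, Fin.succ_lt_succ_iff, Fin.cons_succ, Fin.val_succ,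
      add_lt_add_iff_right]
    rfl

theorem lowerEntry_cons_succ (b : ℕ) (v : Fin n → ℕ) (k : Fin n) :
    lowerEntry (Fin.cons b v : Fin (n + 1) → ℕ) k.succ = Fin.cons b (lowerEntry v k) := by
  rw [lowerEntry, lowerEntry, Fin.cons_update, Fin.cons_succ]

theorem lowerEntry_cons_zero (b : ℕ) (v : Fin n → ℕ) :
    lowerEntry (Fin.cons b v : Fin (n + 1) → ℕ) 0 = Fin.cons (b - 1) v := by
  rw [lowerEntry, Fin.update_cons_zero, Fin.cons_zero]

theorem eraseEntry_cons_zero (b : ℕ) (v : Fin n → ℕ) :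
    eraseEntry (Fin.cons b v : Fin (n + 1) → ℕ) 0 = Fin.snoc v 0 := by
  ext i
  by_cases h : (i : ℕ) < n
  · simp [eraseEntry, Fin.snoc, h]
    rfl
  · simp [eraseEntry, Fin.snoc, h]

theorem comp_snoc_zero (v : Fin n → ℕ) : comp (Fin.snoc v 0 : Fin (n + 1) → ℕ) = comp v := by
  unfold comp
  rw [List.ofFn_succ']
  simp

theorem ascents_snoc_zero {v : Fin n → ℕ} (h : ascents v = ∅) :
    ascents (Fin.snoc v 0 : Fin (n + 1) → ℕ) = ∅ := by
  rw [Finset.eq_empty_iff_forall_notMem] at h ⊢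
  intro k hk
  simp only [ascents, Finset.mem_filter, Finset.mem_univ, true_and] at hk h
  obtain ⟨h0, h1, h2⟩ := hk
  have hk1 : (k : ℕ) + 1 < n := by
    by_contra hc
    exact h2 (by simp [Fin.snoc, hc])
  have hkn : (k : ℕ) < n := by omega
  refine h ⟨k, hkn⟩ ⟨?_, hk1, ?_⟩
  · simp only [Fin.snoc, hkn, dif_pos, cast_eq] at h0
    exact h0
  · simpa [Fin.snoc, hk1] using h2

theorem abbG_of_ascents_eq_empty {ε : Fin n → ℕ} (h : ascents ε = ∅) :
    abbG ε = fundamental n (comp ε) := by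
  rw [abbG, dif_neg (by simp [h])]

theorem abbG_of_nonempty {ε : Fin n → ℕ} (h : (ascents ε).Nonempty) :
    abbG ε = abbG (eraseEntry ε ((ascents ε).max' h)) -
      X ((ascents ε).max' h) *
        abbG (lowerEntry (eraseEntry ε ((ascents ε).max' h)) ((ascents ε).max' h)) := by
  rw [abbG, dif_pos h]

theorem abbG_of_isGreatest {ε : Fin n → ℕ} {k : Fin n} (h : IsGreatest (ascents ε : Set _) k) :
    abbG ε = abbG (eraseEntry ε k) - X k * abbG (lowerEntry (eraseEntry ε k) k) := by
  have hne : (ascents ε).Nonempty := ⟨k, h.1⟩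
  have : (ascents ε).max' hne = k := ((ascents ε).isGreatest_max' hne).unique h
  rw [abbG_of_nonempty hne, this]

theorem coeff_cons_X_succ_mul (j : ℕ) (u : Fin n →₀ ℕ) (k : Fin n)
    (P : MvPolynomial (Fin (n + 1)) ℂ) :
    coeff (Finsupp.cons j u) (X k.succ * P) =
      if k ∈ u.support then coeff (Finsupp.cons j (u - Finsupp.single k 1)) P else 0 := by
  rw [coeff_X_mul']
  refine if_congr ?_ ?_ rfl
  · simp
  · congr 1
    ext i
    refine Fin.cases ?_ (fun i => ?_) i
    · simp
    · simp [Finsupp.single_apply]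

theorem coeff_cons_zero_X_zero_mul (u : Fin n →₀ ℕ) (P : MvPolynomial (Fin (n + 1)) ℂ) :
    coeff (Finsupp.cons 0 u) (X 0 * P) = 0 := by
  rw [coeff_X_mul', if_neg (by simp)]

theorem coeff_cons_succ_X_zero_mul (j : ℕ) (u : Fin n →₀ ℕ) (P : MvPolynomial (Fin (n + 1)) ℂ) :
    coeff (Finsupp.cons (j + 1) u) (X 0 * P) = coeff (Finsupp.cons j u) P := by
  rw [coeff_X_mul', if_pos (by simp)]
  congr 1
  ext i
  refine Fin.cases ?_ (fun i => ?_) i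
  · simp
  · simp

theorem comp_finsupp_cons (a : ℕ) (u : Fin n →₀ ℕ) :
    comp (Finsupp.cons a u) = if a = 0 then comp u else a :: comp u := by
  rw [← comp_cons]
  rfl

theorem eq_zero_of_ascents_eq_empty : ∀ {n : ℕ} {v : Fin n → ℕ}, ascents v = ∅ →
    (∀ h : 0 < n, v ⟨0, h⟩ = 0) → v = 0 := by
  intro n v h h0
  rw [Finset.eq_empty_iff_forall_notMem] at h
  ext ⟨i, hi⟩
  induction i with
  | zero => exact h0 hi
  | succ i ih =>
    by_contra hne
    exact h ⟨i, by omega⟩ (Finset.mem_filter.2 ⟨Finset.mem_univ _, ih (by omega), hi, hne⟩)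

/-- As a polynomial in the first variable, `G_{b v}` has top term `x_1^b G_v`, with `G_v` in the
remaining variables. This is what permits an induction on the number of variables for the
lexicographic leading term. -/
theorem coeff_abbG_cons (b : ℕ) (v : Fin n → ℕ) (u : Fin n →₀ ℕ) :
    (∀ j, b < j → coeff (Finsupp.cons j u) (abbG (Fin.cons b v : Fin (n + 1) → ℕ)) = 0) ∧
      coeff (Finsupp.cons b u) (abbG (Fin.cons b v : Fin (n + 1) → ℕ)) = coeff u (abbG v) := by
  classical
  induction hM : moment (Fin.cons b v : Fin (n + 1) → ℕ) using Nat.strong_induction_on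
    generalizing b v u with
  | _ M IH =>
  subst hM
  by_cases hv : (ascents v).Nonempty
  -- The last ascent lies in the tail, so one step of the recursion for `Fin.cons b v` is the
  -- corresponding step for `v`.
  · set k := (ascents v).max' hv with hk
    have hk' := (ascents v).isGreatest_max' hv
    rw [← hk] at hk'
    have hg : IsGreatest (ascents (Fin.cons b v : Fin (n + 1) → ℕ) : Set (Fin (n + 1))) k.succ := by
      refine ⟨succ_mem_ascents_cons.2 hk'.1, fun i => ?_⟩
      refine Fin.cases (fun _ => Fin.zero_le _) (fun i hi => ?_) i
      exact Fin.succ_le_succ_iff.2 (hk'.2 (succ_mem_ascents_cons.1 hi))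
    have hm := moment_eraseEntry_lt _ _ hg.1
    have hm' := (moment_lowerEntry_le (eraseEntry (Fin.cons b v : Fin (n + 1) → ℕ) k.succ)
      k.succ).trans_lt hm
    rw [abbG_of_isGreatest hg, abbG_of_isGreatest hk']
    rw [eraseEntry_cons_succ] at hm hm' ⊢
    rw [lowerEntry_cons_succ] at hm' ⊢
    have I1 := fun u => IH _ hm b (eraseEntry v k) u rfl
    have I2 := fun u => IH _ hm' b (lowerEntry (eraseEntry v k) k) u rfl
    constructor
    · intro j hj
      rw [coeff_sub, coeff_cons_X_succ_mul, (I1 u).1 j hj, (I2 _).1 j hj]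
      simp
    · rw [coeff_sub, coeff_cons_X_succ_mul, (I1 u).2, (I2 _).2, coeff_sub, coeff_X_mul']
  · rw [Finset.not_nonempty_iff_eq_empty] at hv
    rw [abbG_of_ascents_eq_empty hv]
    by_cases h0 : (0 : Fin (n + 1)) ∈ ascents (Fin.cons b v : Fin (n + 1) → ℕ)
    · have hg : IsGreatest (ascents (Fin.cons b v : Fin (n + 1) → ℕ) : Set (Fin (n + 1))) 0 := by
        refine ⟨h0, fun i => ?_⟩
        refine Fin.cases (fun _ => le_rfl) (fun i hi => ?_) i
        have := succ_mem_ascents_cons.1 hi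
        simp [hv] at this
      have hm := moment_eraseEntry_lt _ _ h0
      have hm' := (moment_lowerEntry_le (eraseEntry (Fin.cons b v : Fin (n + 1) → ℕ) 0)
        0).trans_lt hm
      obtain ⟨rfl, hn, ha⟩ := zero_mem_ascents_cons.1 h0
      rw [abbG_of_isGreatest hg]
      rw [eraseEntry_cons_zero] at hm' ⊢
      rw [abbG_of_ascents_eq_empty (ascents_snoc_zero hv), comp_snoc_zero]
      refine ⟨fun j hj => ?_, ?_⟩
      -- The index is `0 (a+1) β`, and `F_{(a+1)β} - x_1 G_{aβ}` must be free of `x_1`. Lowering the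
      -- exponent of `x_1` and the first part by one preserves refinement, so the two terms cancel.
      · obtain ⟨t, rfl⟩ : ∃ t, j = t + 1 := ⟨j - 1, by omega⟩
        obtain ⟨n, rfl⟩ : ∃ n', n = n' + 1 := ⟨n - 1, by omega⟩
        obtain ⟨a, v, rfl⟩ : ∃ (a : ℕ) (v' : Fin n → ℕ), v = Fin.cons (a + 1) v' := by
          refine ⟨v 0 - 1, Fin.tail v, ?_⟩
          rw [Nat.sub_add_cancel (show 1 ≤ v 0 from Nat.pos_of_ne_zero ha)]
          exact (Fin.cons_self_tail v).symm
        rw [← Fin.cons_snoc_eq_snoc_cons, lowerEntry_cons_zero, Nat.add_sub_cancel] at hm' ⊢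
        have hv' : ascents v = ∅ := by
          rw [Finset.eq_empty_iff_forall_notMem] at hv ⊢
          exact fun i hi => hv i.succ (succ_mem_ascents_cons.2 hi)
        have hs := ascents_snoc_zero hv'
        have hpos : ∀ x ∈ comp u, 0 < x := fun x hx => pos_of_mem_comp hx
        rw [coeff_sub, coeff_cons_succ_X_zero_mul, coeff_fundamental, comp_finsupp_cons,
          if_neg t.succ_ne_zero, comp_cons, if_neg a.succ_ne_zero]
        -- For `a = 0` the vector in the second term may again have an ascent at its first entry, so
        -- the induction hypothesis is needed; otherwise that term is a fundamental polynomial.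
        by_cases ha0 : a = 0
        · subst ha0
          have I := IH _ hm' 0 (Fin.snoc v 0) u rfl
          by_cases ht : t = 0
          · subst ht
            rw [I.2, abbG_of_ascents_eq_empty hs, coeff_fundamental, comp_snoc_zero]
            exact sub_eq_zero.2 (if_congr (refines_cons_self one_pos hpos) rfl rfl)
          · rw [I.1 t (Nat.pos_of_ne_zero ht), if_neg (not_refines_of_lt (by omega) (by omega)),
              sub_zero]
        · have hs' : ascents (Fin.cons a (Fin.snoc v 0 : Fin (n + 1) → ℕ) : Fin (n + 2) → ℕ) = ∅ := by
            rw [Finset.eq_empty_iff_forall_notMem] at hs ⊢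
            intro i
            refine Fin.cases (fun h => ha0 (zero_mem_ascents_cons.1 h).1) (fun i hi => ?_) i
            exact hs i (succ_mem_ascents_cons.1 hi)
          rw [abbG_of_ascents_eq_empty hs', coeff_fundamental, comp_finsupp_cons, comp_cons,
            if_neg ha0, comp_snoc_zero]
          refine sub_eq_zero.2 (if_congr ?_ rfl rfl)
          by_cases ht : t = 0
          · subst ht
            exact refines_one_succ
          · rw [if_neg ht]
            exact refines_succ_succ (Nat.pos_of_ne_zero ha0)
      · rw [coeff_sub, coeff_cons_zero_X_zero_mul, sub_zero, coeff_fundamental,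
          coeff_fundamental, comp_finsupp_cons, if_pos rfl]
    · have hs : ascents (Fin.cons b v : Fin (n + 1) → ℕ) = ∅ := by
        rw [Finset.eq_empty_iff_forall_notMem] at hv ⊢
        intro i
        refine Fin.cases h0 (fun i hi => ?_) i
        exact hv i (succ_mem_ascents_cons.1 hi)
      rw [abbG_of_ascents_eq_empty hs]
      by_cases hb : b = 0
      · subst hb
        have hz : v = 0 := eq_zero_of_ascents_eq_empty hv fun h => by
          by_contra hne
          exact h0 (zero_mem_ascents_cons.2 ⟨rfl, h, hne⟩)
        have hc : comp (0 : Fin n → ℕ) = [] := by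
          simp [comp, List.filter_eq_nil_iff]
        refine ⟨fun j hj => ?_, ?_⟩
        · rw [coeff_fundamental, comp_finsupp_cons, if_neg hj.ne', comp_cons, if_pos rfl, hz, hc,
            if_neg (by simp [refines_nil_right])]
        · rw [coeff_fundamental, coeff_fundamental, comp_finsupp_cons, comp_cons, if_pos rfl,
            if_pos rfl]
      · have hb' := Nat.pos_of_ne_zero hb
        refine ⟨fun j hj => ?_, ?_⟩
        · rw [coeff_fundamental, comp_finsupp_cons, if_neg (hb'.trans hj).ne', comp_cons, if_neg hb,
            if_neg (not_refines_of_lt hb' hj)]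
        · rw [coeff_fundamental, coeff_fundamental, comp_finsupp_cons, comp_cons, if_neg hb,
            if_neg hb]
          have hpos : ∀ x ∈ comp u, 0 < x := fun x hx => pos_of_mem_comp hx
          exact if_congr (refines_cons_self hb' hpos) rfl rfl

theorem abbG_triangular : ∀ {n : ℕ} (ε ν : Fin n →₀ ℕ),
    coeff ε (abbG ε) = 1 ∧ (coeff ν (abbG ε) ≠ 0 → toLex ν ≤ toLex ε) := by
  intro n
  induction n with
  | zero =>
    intro ε ν
    have he : ascents (ε : Fin 0 → ℕ) = ∅ := by
      ext i; exact i.elim0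
    obtain rfl : ν = ε := Subsingleton.elim _ _
    rw [abbG_of_ascents_eq_empty he, coeff_fundamental]
    refine ⟨if_pos ?_, fun _ => le_rfl⟩
    rw [show comp (ν : Fin 0 → ℕ) = [] from rfl, refines_nil_right]
  | succ n ih =>
    intro ε ν
    obtain ⟨b, v, rfl⟩ : ∃ b v, ε = Finsupp.cons b v := ⟨_, _, (Finsupp.cons_tail ε).symm⟩
    obtain ⟨j, u, rfl⟩ : ∃ b v, ν = Finsupp.cons b v := ⟨_, _, (Finsupp.cons_tail ν).symm⟩
    have key := fun u => coeff_abbG_cons b v u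
    refine ⟨(key v).2.trans (ih v v).1, fun h => ?_⟩
    rcases lt_trichotomy j b with hj | rfl | hj
    · refine le_of_lt (Finsupp.Lex.lt_iff.2 ⟨0, fun i hi => absurd hi (Fin.not_lt_zero i), ?_⟩)
      simpa using hj
    · have h' : coeff u (abbG v) ≠ 0 := by rw [← (key u).2]; exact h
      rcases ((ih v u).2 h').eq_or_lt with he | hlt
      · rw [toLex_inj.1 he]
      · obtain ⟨i, h1, h2⟩ := Finsupp.Lex.lt_iff.1 hlt
        refine le_of_lt (Finsupp.Lex.lt_iff.2 ⟨i.succ, fun i' hi' => ?_, ?_⟩)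
        · revert hi'
          refine Fin.cases (fun _ => ?_) (fun i' hi' => ?_) i'
          · simp
          · simpa using h1 i' (Fin.succ_lt_succ_iff.1 hi')
        · simpa using h2
    · exact absurd ((key u).1 j hj) h

/-! ### Stability of transdiagonal vectors. -/

/-- The extension of a vector by zero. -/
def zeroExtend (ε : Fin n → ℕ) (i : ℕ) : ℕ := if h : i < n then ε ⟨i, h⟩ else 0

theorem zeroExtend_coe (ε : Fin n → ℕ) (i : Fin n) : zeroExtend ε i = ε i := by
  simp [zeroExtend]

theorem zeroExtend_of_le (ε : Fin n → ℕ) {i : ℕ} (h : n ≤ i) : zeroExtend ε i = 0 := by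
  simp [zeroExtend, h]

theorem sum_range_zeroExtend (ε : Fin n → ℕ) (k : Fin n) :
    ∑ i ∈ Finset.range (k + 1), zeroExtend ε i = ∑ i ∈ Finset.Iic k, ε i := by
  symm
  refine Finset.sum_bij (fun i _ => (i : ℕ)) ?_ ?_ ?_ ?_
  · intro i hi
    have := Fin.le_def.1 (Finset.mem_Iic.1 hi)
    exact Finset.mem_range.2 (by omega)
  · intro i _ j _ h
    exact Fin.ext h
  · intro i hi
    have := Finset.mem_range.1 hi
    exact ⟨⟨i, by omega⟩, Finset.mem_Iic.2 (Fin.le_def.2 (by simp; omega)), rfl⟩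
  · intro i _
    rw [zeroExtend_coe]

theorem sum_range_zeroExtend_eq_sum (ε : Fin n → ℕ) {j : ℕ} (h : n ≤ j) :
    ∑ i ∈ Finset.range j, zeroExtend ε i = ∑ i, ε i := by
  rw [← Finset.sum_subset (Finset.range_mono h), Finset.sum_range]
  · simp only [zeroExtend_coe]
  · intro i _ hi
    exact zeroExtend_of_le ε (by simpa using hi)

/-- Witnesses `j > n` are harmless, because the partial sums are constant from `n` on. Shifting an
index then needs no check at the right end. -/
theorem isTransdiagonal_iff {ε : Fin n → ℕ} :
    IsTransdiagonal ε ↔ ∃ j, 0 < j ∧ j ≤ ∑ i ∈ Finset.range j, zeroExtend ε i := by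
  simp only [IsTransdiagonal, IsDyck, not_forall, not_le]
  constructor
  · rintro ⟨k, hk⟩
    exact ⟨k + 1, k.1.succ_pos, by rw [sum_range_zeroExtend]; exact hk⟩
  · rintro ⟨j, hj, h⟩
    rcases lt_or_ge n j with hn | hn
    · rw [sum_range_zeroExtend_eq_sum ε hn.le] at h
      have hn0 : 0 < n := by
        by_contra h0
        obtain rfl : n = 0 := by omega
        simp at h
        omega
      refine ⟨⟨n - 1, by omega⟩, ?_⟩
      rw [← sum_range_zeroExtend, sum_range_zeroExtend_eq_sum ε (by simp; omega)]
      simp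
      omega
    · refine ⟨⟨j - 1, by omega⟩, ?_⟩
      rw [← sum_range_zeroExtend]
      simp only [Nat.sub_add_cancel hj]
      omega

theorem isTransdiagonal_of_le_sum {ε : Fin n → ℕ} (hn : 0 < n) (h : n ≤ ∑ i, ε i) :
    IsTransdiagonal ε :=
  isTransdiagonal_iff.2 ⟨n, hn, by rwa [sum_range_zeroExtend_eq_sum ε le_rfl]⟩

theorem IsTransdiagonal.sum_pos {ε : Fin n → ℕ} (h : IsTransdiagonal ε) : 0 < ∑ i, ε i := by
  by_contra h0
  refine h fun k => ?_
  refine (Finset.sum_le_sum_of_subset (Finset.subset_univ _)).trans ?_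
  omega

theorem zeroExtend_eraseEntry (ε : Fin n → ℕ) (k : Fin n) (i : ℕ) :
    zeroExtend (eraseEntry ε k) i = if i < k then zeroExtend ε i else zeroExtend ε (i + 1) := by
  unfold zeroExtend eraseEntry
  have := k.2
  simp only [Fin.lt_def]
  split_ifs <;> first | rfl | omega

theorem sum_range_eraseEntry {ε : Fin n → ℕ} {k : Fin n} (hk : ε k = 0) (j : ℕ) :
    ∑ i ∈ Finset.range j, zeroExtend (eraseEntry ε k) i =
      if j ≤ k then ∑ i ∈ Finset.range j, zeroExtend ε i
      else ∑ i ∈ Finset.range (j + 1), zeroExtend ε i := by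
  induction j with
  | zero => simp
  | succ j ih =>
    have hk' : zeroExtend ε k = 0 := by rw [zeroExtend_coe, hk]
    rw [Finset.sum_range_succ, ih, zeroExtend_eraseEntry]
    rcases lt_trichotomy j (k : ℕ) with h | h | h
    · rw [if_pos h.le, if_pos h, if_pos (by omega), Finset.sum_range_succ]
    · rw [if_pos h.le, if_neg (by omega), if_neg (by omega), Finset.sum_range_succ _ (j + 1),
        Finset.sum_range_succ _ j, h, hk', add_zero]
    · rw [if_neg (by omega), if_neg (by omega), if_neg (by omega), Finset.sum_range_succ _ (j + 1)]

theorem sum_eraseEntry {ε : Fin n → ℕ} {k : Fin n} (hk : ε k = 0) :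
    ∑ i, eraseEntry ε k i = ∑ i, ε i := by
  rw [← sum_range_zeroExtend_eq_sum _ le_rfl, sum_range_eraseEntry hk, if_neg (by simp),
    sum_range_zeroExtend_eq_sum _ n.le_succ]

theorem eraseEntry_self_ne_zero {ε : Fin n → ℕ} {k : Fin n} (hk : k ∈ ascents ε) :
    eraseEntry ε k k ≠ 0 := by
  obtain ⟨-, h, hne⟩ := (Finset.mem_filter.1 hk).2
  simpa [eraseEntry, h] using hne

theorem update_lowerEntry {w : Fin n → ℕ} {k : Fin n} (h : w k ≠ 0) :
    w = Function.update (lowerEntry w k) k (lowerEntry w k k + 1) := by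
  rw [lowerEntry, Function.update_idem, Function.update_self,
    Nat.sub_add_cancel (Nat.pos_of_ne_zero h), Function.update_eq_self]

theorem sum_update_succ (ε : Fin n → ℕ) (k : Fin n) :
    ∑ i, Function.update ε k (ε k + 1) i = ∑ i, ε i + 1 := by
  rw [Finset.sum_update_of_mem (Finset.mem_univ k), ← Finset.add_sum_erase _ ε (Finset.mem_univ k),
    Finset.sdiff_singleton_eq_erase]
  ring

theorem sum_range_update_succ (ε : Fin n → ℕ) (k : Fin n) (j : ℕ) :
    ∑ i ∈ Finset.range j, zeroExtend (Function.update ε k (ε k + 1)) i =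
      ∑ i ∈ Finset.range j, zeroExtend ε i + if (k : ℕ) < j then 1 else 0 := by
  have h : ∀ i, zeroExtend (Function.update ε k (ε k + 1)) i =
      zeroExtend ε i + if (k : ℕ) = i then 1 else 0 := by
    intro i
    by_cases hi : (k : ℕ) = i
    · subst hi
      simp [zeroExtend_coe]
    · unfold zeroExtend
      split_ifs with h
      · rw [Function.update_of_ne (by rintro rfl; exact hi rfl), add_zero]
      · rfl
  simp only [h, Finset.sum_add_distrib, Finset.sum_ite_eq, Finset.mem_range]

theorem IsTransdiagonal.update_succ {ε : Fin n → ℕ} (h : IsTransdiagonal ε) (k : Fin n) :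
    IsTransdiagonal (Function.update ε k (ε k + 1)) := by
  rw [isTransdiagonal_iff] at h ⊢
  obtain ⟨j, h0, h1⟩ := h
  exact ⟨j, h0, by rw [sum_range_update_succ]; omega⟩

theorem IsTransdiagonal.eraseEntry {ε : Fin n → ℕ} (h : IsTransdiagonal ε) {k : Fin n}
    (hk : ε k = 0) : IsTransdiagonal (eraseEntry ε k) := by
  rw [isTransdiagonal_iff] at h ⊢
  obtain ⟨j, h0, h1⟩ := h
  refine ⟨j, h0, ?_⟩
  rw [sum_range_eraseEntry hk, Finset.sum_range_succ]
  split_ifs <;> omega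

/-- If the partial sum witnessing transdiagonality passes the erased zero, erasing shortens it by
one place and lowering costs one unit, so `j - 1` is a witness. -/
theorem IsTransdiagonal.lowerEntry_eraseEntry {ε : Fin n → ℕ} (h : IsTransdiagonal ε) {k : Fin n}
    (hk : k ∈ ascents ε) : IsTransdiagonal (lowerEntry (QuasiInv.eraseEntry ε k) k) := by
  have hk0 : ε k = 0 := (Finset.mem_filter.1 hk).2.1
  have hu := sum_range_update_succ (lowerEntry (QuasiInv.eraseEntry ε k) k) k
  rw [← update_lowerEntry (eraseEntry_self_ne_zero hk)] at hu
  simp only [sum_range_eraseEntry hk0] at hu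
  rw [isTransdiagonal_iff] at h ⊢
  obtain ⟨j, h0, h1⟩ := h
  by_cases hj : j ≤ k
  · refine ⟨j, h0, ?_⟩
    have := hu j
    rw [if_pos hj, if_neg (by omega)] at this
    omega
  · have hj1 : j ≠ 1 := by
      rintro rfl
      have hk1 : (k : ℕ) = 0 := by omega
      rw [Finset.sum_range_one, ← hk1, zeroExtend_coe, hk0] at h1
      omega
    refine ⟨j - 1, by omega, ?_⟩
    have := hu (j - 1)
    rw [Nat.sub_add_cancel h0] at this
    by_cases hj' : j - 1 ≤ k
    · rw [if_pos hj', if_neg (by omega)] at this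
      obtain rfl : j = (k : ℕ) + 1 := by omega
      rw [Finset.sum_range_succ, zeroExtend_coe, hk0] at h1
      simp only [Nat.add_sub_cancel] at this ⊢
      omega
    · rw [if_neg hj', if_pos (by omega)] at this
      omega

/-! ### Homogeneity, triangular rewriting and the linear span of `𝒢`. -/

/-- Induction along the recursion defining the polynomials `G_ε`. -/
theorem abbG_induction {motive : (Fin n → ℕ) → Prop}
    (base : ∀ ε, ascents ε = ∅ → motive ε)
    (step : ∀ ε k, IsGreatest (ascents ε : Set (Fin n)) k → motive (eraseEntry ε k) →
      motive (lowerEntry (eraseEntry ε k) k) → motive ε) (ε : Fin n → ℕ) : motive ε := by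
  induction hM : moment ε using Nat.strong_induction_on generalizing ε with
  | _ M IH =>
    subst hM
    rcases (ascents ε).eq_empty_or_nonempty with h | h
    · exact base ε h
    · have hg := (ascents ε).isGreatest_max' h
      have hm := moment_eraseEntry_lt _ _ hg.1
      exact step ε _ hg (IH _ hm _ rfl) (IH _ ((moment_lowerEntry_le _ _).trans_lt hm) _ rfl)

theorem abbG_isHomogeneous (ε : Fin n → ℕ) : (abbG ε).IsHomogeneous (∑ i, ε i) := by
  induction ε using abbG_induction with
  | base ε h =>
    rw [abbG_of_ascents_eq_empty h, ← comp_sum]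
    exact fundamental_isHomogeneous _
  | step ε k hk h1 h2 =>
    rw [abbG_of_isGreatest hk]
    rw [sum_eraseEntry (Finset.mem_filter.1 hk.1).2.1] at h1
    refine h1.sub ?_
    have h3 := (isHomogeneous_X ℂ k).mul h2
    rwa [add_comm 1, ← sum_update_succ _ k,
      ← update_lowerEntry (eraseEntry_self_ne_zero hk.1),
      sum_eraseEntry (Finset.mem_filter.1 hk.1).2.1] at h3

theorem sum_eq_of_isHomogeneous {P : MvPolynomial (Fin n) ℂ} {d : ℕ} (h : P.IsHomogeneous d)
    {ν : Fin n →₀ ℕ} (hν : coeff ν P ≠ 0) : ∑ i, ν i = d := by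
  rw [← h hν]
  simp [Finsupp.weight_apply, Finsupp.sum_fintype]

/-- Monomials of degree `d` can be rewritten with the polynomials `G_ε`. -/
theorem monomial_mem_of_forall (V : Submodule ℂ (MvPolynomial (Fin n) ℂ)) (d : ℕ)
    (h : ∀ ν : Fin n →₀ ℕ, ∑ i, ν i = d → monomial ν (1 : ℂ) ∈ V ∨ abbG ν ∈ V)
    (ν : Fin n →₀ ℕ) (hν : ∑ i, ν i = d) : monomial ν (1 : ℂ) ∈ V := by
  induction hs : (MonomialOrder.lex (σ := Fin n)).toSyn ν using
    WellFounded.induction (MonomialOrder.lex (σ := Fin n)).wellFoundedLT_syn.wf generalizing ν with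
  | _ x IH =>
  subst hs
  rcases h ν hν with h1 | h1
  · exact h1
  -- All other monomials of `G_ν` are lexicographically smaller and of the same degree, so the
  -- induction hypothesis covers them.
  · have hsum : monomial ν (1 : ℂ) = abbG ν -
        ∑ μ ∈ (abbG ν).support.erase ν, coeff μ (abbG ν) • monomial μ (1 : ℂ) := by
      have hm : ν ∈ (abbG ν).support := by
        rw [mem_support_iff, (abbG_triangular ν ν).1]
        exact one_ne_zero
      rw [eq_sub_iff_add_eq]
      conv_rhs => rw [(abbG ν).as_sum, ← Finset.add_sum_erase _ _ hm, (abbG_triangular ν ν).1]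
      simp [smul_monomial]
    rw [hsum]
    refine V.sub_mem h1 (V.sum_mem fun μ hμ => V.smul_mem _ ?_)
    obtain ⟨hne, hμ⟩ := Finset.mem_erase.1 hμ
    rw [mem_support_iff] at hμ
    refine IH _ ?_ μ ?_ rfl
    · rw [MonomialOrder.lex_lt_iff]
      exact lt_of_le_of_ne ((abbG_triangular ν μ).2 hμ) (fun he => hne (toLex_inj.1 he))
    · rw [sum_eq_of_isHomogeneous (abbG_isHomogeneous ν) hμ, hν]

/-- The linear span of the family `𝒢`. -/
noncomputable def transSpan (n : ℕ) : Submodule ℂ (MvPolynomial (Fin n) ℂ) :=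
  Submodule.span ℂ (abbFamily n)

theorem abbG_mem_transSpan {ε : Fin n → ℕ} (h : IsTransdiagonal ε) : abbG ε ∈ transSpan n :=
  Submodule.subset_span ⟨ε, h, rfl⟩

/-- In degree at least `n` every exponent vector is transdiagonal, so triangular rewriting never
gets stuck. -/
theorem mem_transSpan_of_isHomogeneous {P : MvPolynomial (Fin n) ℂ} {d : ℕ} (hn : 0 < n)
    (hd : n ≤ d) (hP : P.IsHomogeneous d) : P ∈ transSpan n := by
  rw [P.as_sum]
  refine Submodule.sum_mem _ fun ν hν => ?_
  rw [← mul_one (coeff ν P), ← smul_eq_mul, ← smul_monomial]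
  refine Submodule.smul_mem _ _ ?_
  refine monomial_mem_of_forall _ d (fun ν hν => Or.inr ?_) ν
    (sum_eq_of_isHomogeneous hP (mem_support_iff.1 hν))
  exact abbG_mem_transSpan (isTransdiagonal_of_le_sum hn (by omega))

/-- Distinct `G_ε` have distinct leading monomials, so the largest `ε` in a linear combination
cannot cancel. -/
theorem degree_of_mem_transSpan {P : MvPolynomial (Fin n) ℂ} (h : P ∈ transSpan n) (h0 : P ≠ 0) :
    IsTransdiagonal (MonomialOrder.lex.degree P) := by
  have himg : abbFamily n = (fun ε : Fin n →₀ ℕ => abbG ε) '' {ε | IsTransdiagonal ε} := by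
    ext Q
    constructor
    · rintro ⟨ε, hε, rfl⟩
      exact ⟨Finsupp.equivFunOnFinite.symm ε, hε, rfl⟩
    · rintro ⟨ε, hε, rfl⟩
      exact ⟨ε, hε, rfl⟩
  rw [transSpan, himg, Finsupp.mem_span_image_iff_linearCombination] at h
  obtain ⟨c, hc, rfl⟩ := h
  have hne : c.support.Nonempty := by
    rw [Finsupp.support_nonempty_iff]
    rintro rfl
    simp at h0
  obtain ⟨ε, hε, hmax⟩ := Finset.exists_max_image c.support
    (fun ε => (MonomialOrder.lex (σ := Fin n)).toSyn ε) hne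
  have hcoeff : ∀ ν, coeff ν (Finsupp.linearCombination ℂ (fun ε : Fin n →₀ ℕ => abbG ε) c) =
      ∑ μ ∈ c.support, c μ * coeff ν (abbG μ) := by
    intro ν
    rw [Finsupp.linearCombination_apply, Finsupp.sum, coeff_sum]
    simp
  have hdeg : MonomialOrder.lex.degree
      (Finsupp.linearCombination ℂ (fun ε : Fin n →₀ ℕ => abbG ε) c) = ε := by
    apply (MonomialOrder.lex (σ := Fin n)).toSyn.injective
    apply le_antisymm
    · rw [MonomialOrder.degree_le_iff]
      intro ν hν
      rw [mem_support_iff, hcoeff] at hν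
      obtain ⟨μ, hμ, hne⟩ := Finset.exists_ne_zero_of_sum_ne_zero hν
      refine le_trans ?_ (hmax μ hμ)
      rw [MonomialOrder.lex_le_iff]
      exact (abbG_triangular μ ν).2 (right_ne_zero_of_mul hne)
    · apply MonomialOrder.le_degree
      rw [mem_support_iff, hcoeff, Finset.sum_eq_single ε]
      · rw [(abbG_triangular ε ε).1, mul_one]
        exact Finsupp.mem_support_iff.1 hε
      · intro μ hμ hne
        by_contra h
        have h1 := (abbG_triangular μ ε).2 (right_ne_zero_of_mul h)
        have h2 := MonomialOrder.lex_le_iff.1 (hmax μ hμ)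
        exact hne (toLex_inj.1 (le_antisymm h2 h1))
      · intro h
        exact absurd hε h
  rw [hdeg]
  exact hc hε

theorem degree_abbG (ε : Fin n →₀ ℕ) : MonomialOrder.lex.degree (abbG ε) = ε := by
  apply (MonomialOrder.lex (σ := Fin n)).toSyn.injective
  apply le_antisymm
  · rw [MonomialOrder.degree_le_iff]
    intro ν hν
    rw [MonomialOrder.lex_le_iff]
    exact (abbG_triangular ε ν).2 (mem_support_iff.1 hν)
  · apply MonomialOrder.le_degree
    rw [mem_support_iff, (abbG_triangular ε ε).1]
    exact one_ne_zero

theorem leadingTerm_abbG (ε : Fin n →₀ ℕ) :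
    MonomialOrder.lex.leadingTerm (abbG ε) = monomial ε (1 : ℂ) := by
  rw [MonomialOrder.leadingTerm, MonomialOrder.leadingCoeff, degree_abbG, (abbG_triangular ε ε).1]

/-! ### Multiplying `G_ε` by variables. -/

/-- The vector obtained by inserting a zero at `k` and forgetting the last entry. -/
def insertZero (w : Fin n → ℕ) (k : Fin n) (i : Fin n) : ℕ :=
  if i < k then w i else if i = k then 0 else zeroExtend w (i - 1)

theorem insertZero_self (w : Fin n → ℕ) (k : Fin n) : insertZero w k k = 0 := by
  simp [insertZero]

theorem insertZero_of_lt {w : Fin n → ℕ} {k i : Fin n} (h : k < i) :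
    insertZero w k i = zeroExtend w (i - 1) := by
  rw [insertZero, if_neg h.asymm, if_neg h.ne']

theorem eraseEntry_insertZero {w : Fin n → ℕ} (k : Fin n)
    (hw : ∀ i : Fin n, n ≤ (i : ℕ) + 1 → w i = 0) : eraseEntry (insertZero w k) k = w := by
  ext i
  unfold eraseEntry
  split_ifs with h1 h2
  · rw [insertZero, if_pos h1]
  · rw [insertZero_of_lt (by rw [Fin.lt_def] at *; simp; omega)]
    exact zeroExtend_coe w i
  · exact (hw i (by omega)).symm

theorem isGreatest_ascents_insertZero {w : Fin n → ℕ} {k : Fin n} (hk : (k : ℕ) + 1 < n)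
    (hwk : w k ≠ 0) (hw : ∀ i ∈ ascents w, i ≤ k) :
    IsGreatest (ascents (insertZero w k) : Set (Fin n)) k := by
  constructor
  · refine Finset.mem_filter.2 ⟨Finset.mem_univ _, insertZero_self w k, hk, ?_⟩
    rw [insertZero_of_lt (by rw [Fin.lt_def]; simp)]
    simpa [zeroExtend_coe] using hwk
  · intro i hi
    obtain ⟨h0, h1, h2⟩ := (Finset.mem_filter.1 hi).2
    by_contra hlt
    rw [not_le] at hlt
    have hlt' := Fin.lt_def.1 hlt
    rw [insertZero_of_lt hlt] at h0
    rw [insertZero_of_lt (by rw [Fin.lt_def]; simp; omega)] at h2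
    simp only [Nat.add_sub_cancel, zeroExtend_coe] at h2
    have hi1 : zeroExtend w ((i : ℕ) - 1) = w ⟨i - 1, by omega⟩ :=
      zeroExtend_coe w ⟨i - 1, by omega⟩
    rw [hi1] at h0
    have hmem : (⟨i - 1, by omega⟩ : Fin n) ∈ ascents w := by
      refine Finset.mem_filter.2 ⟨Finset.mem_univ _, h0, ?_⟩
      simp only [Nat.sub_add_cancel (show 1 ≤ (i : ℕ) by omega)]
      exact ⟨i.2, h2⟩
    have := Fin.le_def.1 (hw _ hmem)
    simp only at this
    have he : (⟨i - 1, by omega⟩ : Fin n) = k := Fin.ext (by simp; omega)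
    rw [he] at h0
    exact hwk h0

/-- This is the defining recursion solved for `x_k G_ε`. It applies because no ascent of `ε` lies
beyond `k`, so the inserted zero becomes the last ascent, and because the final entry is zero, so
the insertion loses nothing. The bound on the ascents survives, which permits multiplying next by a
variable of the same or larger index. -/
theorem X_mul_abbG {ε : Fin n → ℕ} {k : Fin n} (hk : (k : ℕ) + 1 < n)
    (hε : ∀ i ∈ ascents ε, i ≤ k) (hlast : ∀ i : Fin n, n ≤ (i : ℕ) + 1 → ε i = 0) :
    X k * abbG ε = abbG (Function.update ε k (ε k + 1)) -
        abbG (insertZero (Function.update ε k (ε k + 1)) k) ∧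
      (∀ i ∈ ascents (Function.update ε k (ε k + 1)), i ≤ k) ∧
      ∀ i ∈ ascents (insertZero (Function.update ε k (ε k + 1)) k), i ≤ k := by
  set w := Function.update ε k (ε k + 1) with hwdef
  have hwk : w k ≠ 0 := by simp [hwdef]
  have hne : ∀ i, i ≠ k → w i = ε i := fun i hi => Function.update_of_ne hi _ _
  have hw : ∀ i ∈ ascents w, i ≤ k := by
    intro i hi
    by_contra hlt
    rw [not_le] at hlt
    obtain ⟨h0, h1, h2⟩ := (Finset.mem_filter.1 hi).2
    rw [hne _ hlt.ne'] at h0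
    rw [hne _ (by rw [Fin.lt_def] at hlt; rw [Ne, Fin.ext_iff]; simp; omega)] at h2
    exact hlt.not_ge (hε i (Finset.mem_filter.2 ⟨Finset.mem_univ _, h0, h1, h2⟩))
  have hg := isGreatest_ascents_insertZero hk hwk hw
  refine ⟨?_, hw, fun i hi => hg.2 hi⟩
  have hwlast : ∀ i : Fin n, n ≤ (i : ℕ) + 1 → w i = 0 := by
    intro i hi
    rw [hne i (by rintro rfl; omega), hlast i hi]
  rw [abbG_of_isGreatest hg, eraseEntry_insertZero k hwlast]
  have hl : lowerEntry w k = ε := by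
    rw [lowerEntry, hwdef, Function.update_idem, Function.update_self, Nat.add_sub_cancel,
      Function.update_eq_self]
  rw [hl]
  ring

theorem IsTransdiagonal.insertZero_update {ε : Fin n → ℕ} (h : IsTransdiagonal ε) {k : Fin n}
    (hk : (k : ℕ) + 1 < n) (hlast : ∀ i : Fin n, n ≤ (i : ℕ) + 1 → ε i = 0) :
    IsTransdiagonal (insertZero (Function.update ε k (ε k + 1)) k) := by
  have hs := sum_range_eraseEntry (insertZero_self (Function.update ε k (ε k + 1)) k)
  rw [eraseEntry_insertZero] at hs
  · rw [isTransdiagonal_iff] at h ⊢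
    obtain ⟨j, h0, h1⟩ := h
    have h2 := hs j
    rw [sum_range_update_succ] at h2
    by_cases hj : j ≤ k
    · rw [if_neg (by omega), if_pos hj] at h2
      exact ⟨j, h0, by omega⟩
    · rw [if_pos (by omega), if_neg hj] at h2
      exact ⟨j + 1, by omega, by omega⟩
  · intro i hi
    rw [Function.update_of_ne (by rintro rfl; omega), hlast i hi]

/-- Multiplying by variables of increasing index does not leave the span of `𝒢`, as long as there
is room in the index vectors. -/
theorem monomial_mul_abbG_mem_transSpan (d : ℕ) : ∀ (η : Fin n →₀ ℕ) (ε : Fin n → ℕ) (k : ℕ),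
    ∑ i, η i = d → IsTransdiagonal ε → (∀ i ∈ ascents ε, (i : ℕ) ≤ k) →
    (∀ i, η i ≠ 0 → k ≤ i) → (∀ i : Fin n, n ≤ i + d → ε i = 0) →
    (∀ i : Fin n, ∑ j ∈ Finset.Ici i, η j + i + 1 ≤ n) →
    monomial η (1 : ℂ) * abbG ε ∈ transSpan n := by
  induction d with
  | zero =>
    intro η ε k hd hε _ _ _ _
    have : η = 0 := by
      ext i
      exact (Finset.sum_eq_zero_iff.1 hd) i (Finset.mem_univ i)
    subst this
    rw [show monomial (0 : Fin n →₀ ℕ) (1 : ℂ) = 1 from rfl, one_mul]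
    exact abbG_mem_transSpan hε
  | succ d ih =>
    intro η ε k hd hε hasc hk hlen hrev
    have hne : η.support.Nonempty := by
      rw [Finsupp.support_nonempty_iff]
      rintro rfl
      simp at hd
    obtain ⟨p, hpη, hmin⟩ : ∃ p, η p ≠ 0 ∧ ∀ i, η i ≠ 0 → p ≤ i :=
      ⟨η.support.min' hne, Finsupp.mem_support_iff.1 (Finset.min'_mem _ hne), fun i hi =>
        Finset.min'_le _ _ (Finsupp.mem_support_iff.2 hi)⟩
    have hkp : k ≤ p := hk p hpη
    -- The smallest index `p` of `η` is treated first, so the whole degree `d + 1` sits at indices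
    -- at least `p`, and `hrev p` bounds it.
    have hpd : d + 1 + p + 1 ≤ n := by
      rw [← hd]
      refine le_trans (le_of_eq ?_) (hrev p)
      congr 2
      symm
      refine Finset.sum_subset (Finset.subset_univ _) fun i _ hi => ?_
      by_contra h
      exact hi (Finset.mem_Ici.2 (hmin i h))
    have hpn : (p : ℕ) + 1 < n := by omega
    have hlast : ∀ i : Fin n, n ≤ (i : ℕ) + 1 → ε i = 0 := fun i hi => hlen i (by omega)
    obtain ⟨hX, ha1, ha2⟩ := X_mul_abbG hpn
      (fun i hi => Fin.le_def.2 ((hasc i hi).trans hkp)) hlast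
    obtain ⟨η', rfl⟩ : ∃ η', η = η' + Finsupp.single p 1 :=
      ⟨η - Finsupp.single p 1, (tsub_add_cancel_of_le
        (Finsupp.single_le_iff.2 (Nat.one_le_iff_ne_zero.2 hpη))).symm⟩
    have hle : ∀ i, η' i ≤ (η' + Finsupp.single p 1 : Fin n →₀ ℕ) i := fun i => by simp
    have hd' : ∑ i, η' i = d := by
      simp only [Finsupp.add_apply, Finset.sum_add_distrib, Finsupp.single_apply,
        Finset.sum_ite_eq, Finset.mem_univ, if_true] at hd
      omega
    have hmin' : ∀ i, η' i ≠ 0 → (p : ℕ) ≤ i := fun i hi =>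
      Fin.le_def.1 (hmin i (by have := hle i; omega))
    have hrev' : ∀ i : Fin n, ∑ j ∈ Finset.Ici i, η' j + i + 1 ≤ n := fun i =>
      le_trans (by gcongr with j; exact hle j) (hrev i)
    rw [show monomial (η' + Finsupp.single p 1) (1 : ℂ) * abbG ε =
        monomial η' (1 : ℂ) * (X p * abbG ε) by
      rw [← mul_assoc, X, monomial_mul, one_mul], hX, mul_sub]
    -- The first vector gains a unit at `p`; in the second the entries from `p` on also move one
    -- place to the right. At most one of the `d + 1` trailing zeros is used up, leaving `d`.
    refine Submodule.sub_mem _ ?_ ?_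
    · refine ih η' _ p hd' (hε.update_succ p) (fun i hi => ha1 i hi) hmin' (fun i hi => ?_) hrev'
      rw [Function.update_of_ne (by rintro rfl; omega), hlen i (by omega)]
    · refine ih η' _ p hd' (hε.insertZero_update hpn hlast) (fun i hi => ha2 i hi) hmin'
        (fun i hi => ?_) hrev'
      rw [insertZero_of_lt (by rw [Fin.lt_def]; omega)]
      have hi1 : (i : ℕ) - 1 < n := by omega
      rw [zeroExtend, dif_pos hi1, Function.update_of_ne (by rw [Ne, Fin.ext_iff]; simp; omega),
        hlen _ (by simp; omega)]

theorem isTransdiagonal_of_ascents_eq_empty {κ : Fin n → ℕ} (h : ascents κ = ∅) (h0 : κ ≠ 0) :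
    IsTransdiagonal κ := by
  have : ∃ h : 0 < n, κ ⟨0, h⟩ ≠ 0 := by
    by_contra hc
    push Not at hc
    exact h0 (eq_zero_of_ascents_eq_empty h hc)
  obtain ⟨hn, hκ⟩ := this
  refine isTransdiagonal_iff.2 ⟨1, one_pos, ?_⟩
  rw [Finset.sum_range_one, zeroExtend, dif_pos hn]
  omega

/-- Total degree at least `n` is automatic. Below `n`, the composition `κ` has at most `∑ i, κ i`
parts, so it leaves enough trailing zeros for all the factors of `X^η`. -/
theorem monomial_mul_abbG_mem_of_ascents_eq_empty (hn : 0 < n) {η : Fin n →₀ ℕ} {κ : Fin n → ℕ}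
    (hη : ∀ i : Fin n, ∑ j ∈ Finset.Ici i, η j + i + 1 ≤ n) (hκ : ascents κ = ∅) (h0 : κ ≠ 0) :
    monomial η (1 : ℂ) * abbG κ ∈ transSpan n := by
  rcases le_or_gt n (∑ i, η i + ∑ i, κ i) with h | h
  · refine mem_transSpan_of_isHomogeneous hn h (IsHomogeneous.mul ?_ (abbG_isHomogeneous κ))
    refine isHomogeneous_monomial 1 ?_
    simp [Finsupp.degree_eq_sum]
  · refine monomial_mul_abbG_mem_transSpan _ η κ 0 rfl (isTransdiagonal_of_ascents_eq_empty hκ h0)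
      (by simp [hκ]) (fun _ _ => Nat.zero_le _) (fun i hi => ?_) hη
    by_contra hne
    -- Without ascents, a nonzero entry at `i` forces all earlier entries to be nonzero.
    have hpos : ∀ t (ht : t ≤ (i : ℕ)), κ ⟨i - t, by omega⟩ ≠ 0 := by
      intro t
      induction t with
      | zero => exact fun _ => hne
      | succ t iht =>
        intro ht hz
        have hmem : (⟨i - (t + 1), by omega⟩ : Fin n) ∈ ascents κ := by
          refine Finset.mem_filter.2 ⟨Finset.mem_univ _, hz, ?_⟩
          simp only [show (i : ℕ) - (t + 1) + 1 = i - t by omega]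
          exact ⟨by omega, iht (by omega)⟩
        simp [hκ] at hmem
    have hcard : (i : ℕ) + 1 ≤ ∑ j, κ j := by
      calc (i : ℕ) + 1 = ∑ j ∈ Finset.Iic i, 1 := by simp
        _ ≤ ∑ j ∈ Finset.Iic i, κ j := by
            refine Finset.sum_le_sum fun j hj => ?_
            have hj := Fin.le_def.1 (Finset.mem_Iic.1 hj)
            have := hpos (i - j) (by omega)
            simp only [show (i : ℕ) - (i - j) = j by omega] at this
            exact Nat.one_le_iff_ne_zero.2 this
        _ ≤ _ := Finset.sum_le_sum_of_subset (Finset.subset_univ _)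
    omega

/-! ### Expanding quasi-symmetric polynomials in fundamental ones. -/

theorem comp_eraseEntry : ∀ {n : ℕ} {ε : Fin n → ℕ} {k : Fin n}, ε k = 0 →
    comp (eraseEntry ε k) = comp ε := by
  intro n
  induction n with
  | zero => exact fun {_ k} => k.elim0
  | succ n ih =>
    intro ε k hk
    obtain ⟨b, v, rfl⟩ : ∃ (b : ℕ) (v : Fin n → ℕ), ε = Fin.cons b v :=
      ⟨_, _, (Fin.cons_self_tail ε).symm⟩
    revert hk
    refine Fin.cases (fun hk => ?_) (fun k hk => ?_) k
    · obtain rfl : b = 0 := hk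
      rw [eraseEntry_cons_zero, comp_snoc_zero, comp_cons, if_pos rfl]
    · rw [eraseEntry_cons_succ, comp_cons, comp_cons, ih (by simpa using hk)]

/-- Moving the zero of an ascent to the end keeps the composition, hence the coefficient, but gives
a lexicographically larger monomial. -/
theorem IsQSym.ascents_degree_eq_empty {P : MvPolynomial (Fin n) ℂ} (hP : IsQSym P) (h0 : P ≠ 0) :
    ascents (MonomialOrder.lex.degree P) = ∅ := by
  rw [Finset.eq_empty_iff_forall_notMem]
  intro k hk
  set ν := MonomialOrder.lex.degree P
  have hk0 : ν k = 0 := (Finset.mem_filter.1 hk).2.1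
  let μ : Fin n →₀ ℕ := Finsupp.equivFunOnFinite.symm (eraseEntry ν k)
  have hμ : coeff μ P = coeff ν P := hP _ _ (comp_eraseEntry hk0)
  have hlt : toLex ν < toLex μ := by
    refine Finsupp.Lex.lt_iff.2 ⟨k, fun i hi => ?_, ?_⟩
    · simp [μ, eraseEntry, hi]
    · have := eraseEntry_self_ne_zero hk
      simp only [ofLex_toLex, hk0]
      exact Nat.pos_of_ne_zero this
  have hne : coeff ν P ≠ 0 := MonomialOrder.lex.coeff_degree_ne_zero_iff.2 h0
  rw [← hμ, MonomialOrder.coeff_eq_zero_of_lt (MonomialOrder.lex_lt_iff.2 hlt)] at hne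
  exact hne rfl

theorem constantCoeff_abbG {κ : Fin n → ℕ} (h : 0 < ∑ i, κ i) : constantCoeff (abbG κ) = 0 := by
  by_contra hne
  have := sum_eq_of_isHomogeneous (abbG_isHomogeneous κ) hne
  simp at this
  simp only [this] at h
  simp_all

/-- The leading exponent of `P` has the form `α 0 ⋯ 0`, so a multiple of `F_α` removes the leading
term and leaves a smaller quasi-symmetric polynomial. -/
theorem IsQSym.mem_span_abbG {P : MvPolynomial (Fin n) ℂ} (hP : IsQSym P)
    (h0 : constantCoeff P = 0) :
    P ∈ Submodule.span ℂ ((fun κ : Fin n → ℕ => abbG κ) '' {κ | ascents κ = ∅ ∧ κ ≠ 0}) := by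
  induction hs : (MonomialOrder.lex (σ := Fin n)).toSyn (MonomialOrder.lex.degree P) using
    WellFounded.induction (MonomialOrder.lex (σ := Fin n)).wellFoundedLT_syn.wf generalizing P with
  | _ x IH =>
  subst hs
  by_cases hP0 : P = 0
  · rw [hP0]
    exact Submodule.zero_mem _
  have hasc := hP.ascents_degree_eq_empty hP0
  set ν := MonomialOrder.lex.degree P with hν
  have hν0 : (ν : Fin n → ℕ) ≠ 0 := by
    intro h
    have : ν = 0 := DFunLike.coe_injective h
    apply MonomialOrder.lex.coeff_degree_ne_zero_iff.2 hP0
    rw [← hν, this]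
    exact h0
  have hmem : abbG ν ∈
      Submodule.span ℂ ((fun κ : Fin n → ℕ => abbG κ) '' {κ | ascents κ = ∅ ∧ κ ≠ 0}) :=
    Submodule.subset_span ⟨ν, ⟨hasc, hν0⟩, rfl⟩
  have hG : IsQSym (abbG (ν : Fin n → ℕ)) := by
    rw [abbG_of_ascents_eq_empty hasc]
    exact isQSym_fundamental _
  have hG0 := constantCoeff_abbG (isTransdiagonal_of_ascents_eq_empty hasc hν0).sum_pos
  set Q := P - coeff ν P • abbG (ν : Fin n → ℕ) with hQdef
  have hQ : IsQSym Q := hP.sub (hG.smul _)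
  have hQ0 : constantCoeff Q = 0 := by
    rw [hQdef, map_sub, h0, smul_eq_C_mul, map_mul, hG0, mul_zero, sub_zero]
  have hPQ : P = Q + coeff ν P • abbG (ν : Fin n → ℕ) := by rw [hQdef, sub_add_cancel]
  rw [hPQ]
  refine Submodule.add_mem _ ?_ (Submodule.smul_mem _ _ hmem)
  by_cases hQz : Q = 0
  · rw [hQz]
    exact Submodule.zero_mem _
  refine IH _ ?_ hQ hQ0 rfl
  have hle : ∀ μ, (MonomialOrder.lex (σ := Fin n)).toSyn ν <
      (MonomialOrder.lex (σ := Fin n)).toSyn μ → coeff μ Q = 0 := by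
    intro μ hμ
    have h1 : coeff μ P = 0 := MonomialOrder.coeff_eq_zero_of_lt hμ
    have h2 : coeff μ (abbG (ν : Fin n → ℕ)) = 0 := by
      by_contra hne
      exact ((abbG_triangular ν μ).2 hne).not_gt (MonomialOrder.lex_lt_iff.1 hμ)
    rw [hQdef, coeff_sub, coeff_smul, h1, h2, smul_zero, sub_zero]
  have hν' : coeff ν Q = 0 := by
    rw [hQdef, coeff_sub, coeff_smul, (abbG_triangular ν ν).1, smul_eq_mul, mul_one, sub_self]
  have hne := MonomialOrder.lex.coeff_degree_ne_zero_iff.2 hQz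
  rcases lt_trichotomy ((MonomialOrder.lex (σ := Fin n)).toSyn (MonomialOrder.lex.degree Q))
    ((MonomialOrder.lex (σ := Fin n)).toSyn ν) with h | h | h
  · exact h
  · rw [(MonomialOrder.lex (σ := Fin n)).toSyn.injective h] at hne
    exact absurd hν' hne
  · exact absurd (hle _ h) hne

/-! ### Spanning by reversed Dyck monomials over the quasi-symmetric polynomials. -/

/-- The span of the products `X^μ q`, with `q` quasi-symmetric without constant term and `μ` of
degree less than `d`. -/
noncomputable def posSpan (n d : ℕ) : Submodule ℂ (MvPolynomial (Fin n) ℂ) :=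
  Submodule.span ℂ {P | ∃ (μ : Fin n →₀ ℕ) (q : MvPolynomial (Fin n) ℂ),
    P = monomial μ 1 * q ∧ IsQSym q ∧ constantCoeff q = 0 ∧ ∑ i, μ i < d}

theorem X_mul_mem_posSpan {d : ℕ} (k : Fin n) {P : MvPolynomial (Fin n) ℂ}
    (h : P ∈ posSpan n d) : X k * P ∈ posSpan n (d + 1) := by
  induction h using Submodule.span_induction with
  | mem P h =>
    obtain ⟨μ, q, rfl, hq, h0, hd⟩ := h
    refine Submodule.subset_span ⟨Finsupp.single k 1 + μ, q, ?_, hq, h0, ?_⟩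
    · rw [← mul_assoc, X, monomial_mul, one_mul]
    · simp [Finset.sum_add_distrib, Finsupp.single_apply]
      omega
  | zero => rw [mul_zero]; exact Submodule.zero_mem _
  | add P Q _ _ hP hQ => rw [mul_add]; exact Submodule.add_mem _ hP hQ
  | smul c P _ hP => rw [mul_smul_comm]; exact Submodule.smul_mem _ _ hP

/-- Both branches of the recursion remain transdiagonal, so it ends at polynomials `F_α` of positive
degree. The strict degree drop in `μ` feeds the induction on degree in `monomial_mem_revDyckSpan`.
-/
theorem abbG_mem_posSpan {ε : Fin n → ℕ} (h : IsTransdiagonal ε) :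
    abbG ε ∈ posSpan n (∑ i, ε i) := by
  induction ε using abbG_induction with
  | base ε hasc =>
    refine Submodule.subset_span ⟨0, abbG ε, ?_, ?_, constantCoeff_abbG h.sum_pos, ?_⟩
    · rw [show monomial (0 : Fin n →₀ ℕ) (1 : ℂ) = 1 from rfl, one_mul]
    · rw [abbG_of_ascents_eq_empty hasc]
      exact isQSym_fundamental _
    · simpa using h.sum_pos
  | step ε k hk h1 h2 =>
    have hk0 := (Finset.mem_filter.1 hk.1).2.1
    have h1 := h1 (h.eraseEntry hk0)
    have h2 := X_mul_mem_posSpan k (h2 (h.lowerEntry_eraseEntry hk.1))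
    rw [← sum_update_succ _ k, ← update_lowerEntry (eraseEntry_self_ne_zero hk.1)] at h2
    rw [sum_eraseEntry hk0] at h1 h2
    rw [abbG_of_isGreatest hk]
    exact Submodule.sub_mem _ h1 h2

/-- The span of the products `X^η q` with `q` quasi-symmetric and the reversal of `η` Dyck. -/
noncomputable def revDyckSpan (n : ℕ) : Submodule ℂ (MvPolynomial (Fin n) ℂ) :=
  Submodule.span ℂ {P | ∃ (η : Fin n →₀ ℕ) (q : MvPolynomial (Fin n) ℂ),
    P = monomial η 1 * q ∧ IsQSym q ∧ ∀ i : Fin n, ∑ j ∈ Finset.Ici i, η j + i + 1 ≤ n}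

theorem mul_mem_revDyckSpan {P q : MvPolynomial (Fin n) ℂ} (hP : P ∈ revDyckSpan n)
    (hq : IsQSym q) : P * q ∈ revDyckSpan n := by
  induction hP using Submodule.span_induction with
  | mem P h =>
    obtain ⟨η, q', rfl, hq', hη⟩ := h
    exact Submodule.subset_span ⟨η, q' * q, mul_assoc _ _ _, hq'.mul hq, hη⟩
  | zero => rw [zero_mul]; exact Submodule.zero_mem _
  | add P Q _ _ hP hQ => rw [add_mul]; exact Submodule.add_mem _ hP hQ
  | smul c P _ hP => rw [smul_mul_assoc]; exact Submodule.smul_mem _ _ hP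

theorem sum_mapDomain_rev (ν : Fin n →₀ ℕ) : ∑ i, ν.mapDomain Fin.rev i = ∑ i, ν i := by
  rw [← Equiv.sum_comp Fin.revPerm fun i => ν.mapDomain Fin.rev i]
  exact Finset.sum_congr rfl fun i _ => Finsupp.mapDomain_apply Fin.rev_injective _ _

theorem mapDomain_rev_rev (ν : Fin n →₀ ℕ) : (ν.mapDomain Fin.rev).mapDomain Fin.rev = ν := by
  rw [← Finsupp.mapDomain_comp, show (Fin.rev ∘ Fin.rev : Fin n → Fin n) = id by ext i; simp,
    Finsupp.mapDomain_id]

theorem IsDyck.sum_Ici_mapDomain_rev {ν : Fin n →₀ ℕ} (h : IsDyck ν) (i : Fin n) :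
    ∑ j ∈ Finset.Ici i, ν.mapDomain Fin.rev j + i + 1 ≤ n := by
  have h1 := h (Fin.rev i)
  have h2 : ∑ j ∈ Finset.Ici i, ν.mapDomain Fin.rev j = ∑ j ∈ Finset.Iic (Fin.rev i), ν j := by
    refine Finset.sum_bij (fun j _ => Fin.rev j) (fun j hj => ?_)
      (fun _ _ _ _ hab => Fin.rev_injective hab) (fun j hj => ⟨Fin.rev j, ?_, Fin.rev_rev j⟩)
      (fun j _ => ?_)
    · exact Finset.mem_Iic.2 (Fin.rev_le_rev.2 (Finset.mem_Ici.1 hj))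
    · exact Finset.mem_Ici.2 (Fin.le_rev_iff.1 (Finset.mem_Iic.1 hj))
    · conv_lhs => rw [← Fin.rev_rev j]
      exact Finsupp.mapDomain_apply Fin.rev_injective _ _
  rw [Fin.val_rev] at h1
  omega

/-- A Dyck monomial reverses into a generator. A transdiagonal one is rewritten by `G_ν`, which is a
sum of lower-degree monomials times quasi-symmetric factors. The reversal is legitimate since
quasi-symmetry is stable under it. -/
theorem monomial_mem_revDyckSpan (d : ℕ) : ∀ ν : Fin n →₀ ℕ, ∑ i, ν i = d →
    monomial ν (1 : ℂ) ∈ revDyckSpan n := by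
  induction d using Nat.strong_induction_on with
  | _ d IH =>
  have key : ∀ ν : Fin n →₀ ℕ, ∑ i, ν i = d → monomial ν (1 : ℂ) ∈
      (revDyckSpan n).comap (rename (Fin.rev : Fin n → Fin n)).toLinearMap := by
    refine monomial_mem_of_forall _ d fun ν hν => ?_
    simp only [Submodule.mem_comap, AlgHom.toLinearMap_apply]
    by_cases hdyck : IsDyck ν
    · left
      rw [rename_monomial]
      exact Submodule.subset_span
        ⟨_, 1, (mul_one _).symm, IsQSym.one, hdyck.sum_Ici_mapDomain_rev⟩
    · right
      have h := abbG_mem_posSpan (ε := ν) hdyck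
      rw [hν] at h
      generalize abbG ν = P at h
      induction h using Submodule.span_induction with
      | mem P h =>
        obtain ⟨μ, q, rfl, hq, h0, hd⟩ := h
        rw [map_mul, rename_monomial]
        exact mul_mem_revDyckSpan (IH _ hd _ (sum_mapDomain_rev μ)) hq.rename_rev
      | zero => rw [map_zero]; exact Submodule.zero_mem _
      | add P Q _ _ hP hQ => rw [map_add]; exact Submodule.add_mem _ hP hQ
      | smul c P _ hP => rw [map_smul]; exact Submodule.smul_mem _ _ hP
  intro ν hν
  have h := key (ν.mapDomain Fin.rev) ((sum_mapDomain_rev ν).trans hν)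
  rwa [Submodule.mem_comap, AlgHom.toLinearMap_apply, rename_monomial, mapDomain_rev_rev] at h

theorem mem_revDyckSpan (P : MvPolynomial (Fin n) ℂ) : P ∈ revDyckSpan n := by
  rw [P.as_sum]
  refine Submodule.sum_mem _ fun ν _ => ?_
  rw [← mul_one (coeff ν P), ← smul_eq_mul, ← smul_monomial]
  exact Submodule.smul_mem _ _ (monomial_mem_revDyckSpan _ ν rfl)

/-- The quasi-symmetric factor `q'` coming from `P` is absorbed into `q`; only the product of a
reversed Dyck monomial with some `F_α` remains. -/
theorem mul_mem_transSpan (hn : 0 < n) (P : MvPolynomial (Fin n) ℂ) {q : MvPolynomial (Fin n) ℂ}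
    (hq : IsQSym q) (h0 : constantCoeff q = 0) : P * q ∈ transSpan n := by
  have hP := mem_revDyckSpan P
  induction hP using Submodule.span_induction with
  | mem P h =>
    obtain ⟨η, q', rfl, hq', hη⟩ := h
    have h := (hq'.mul hq).mem_span_abbG (by rw [map_mul, h0, mul_zero])
    rw [mul_assoc]
    generalize q' * q = Q at h
    induction h using Submodule.span_induction with
    | mem Q h =>
      obtain ⟨κ, ⟨h1, h2⟩, rfl⟩ := h
      exact monomial_mul_abbG_mem_of_ascents_eq_empty hn hη h1 h2
    | zero => rw [mul_zero]; exact Submodule.zero_mem _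
    | add P Q _ _ hP hQ => rw [mul_add]; exact Submodule.add_mem _ hP hQ
    | smul c P _ hP => rw [mul_smul_comm]; exact Submodule.smul_mem _ _ hP
  | zero => rw [zero_mul]; exact Submodule.zero_mem _
  | add P Q _ _ hP hQ => rw [add_mul]; exact Submodule.add_mem _ hP hQ
  | smul c P _ hP => rw [smul_mul_assoc]; exact Submodule.smul_mem _ _ hP

/-! ### The Gröbner basis for `m = 1`. -/

/-- The ideal generated by the quasi-symmetric polynomials without constant term. -/
noncomputable def qsymIdeal (n : ℕ) : Ideal (MvPolynomial (Fin n) ℂ) :=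
  Ideal.span {q | IsQSym q ∧ constantCoeff q = 0}

theorem mem_transSpan_of_mem_qsymIdeal {P : MvPolynomial (Fin n) ℂ} (h : P ∈ qsymIdeal n) :
    P ∈ transSpan n := by
  obtain ⟨t, f, g, rfl⟩ := Submodule.mem_span_set'.1 h
  refine Submodule.sum_mem _ fun i _ => ?_
  rw [smul_eq_mul]
  rcases Nat.eq_zero_or_pos n with rfl | hn
  -- Without variables the only coefficient is the constant one, so the generator vanishes.
  · have h0 : coeff 0 (g i : MvPolynomial (Fin 0) ℂ) = 0 := (g i).2.2
    have : (g i : MvPolynomial (Fin 0) ℂ) = 0 := by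
      ext ν
      rw [Subsingleton.elim ν 0, h0, coeff_zero]
    rw [this, mul_zero]
    exact Submodule.zero_mem _
  · exact mul_mem_transSpan hn _ (g i).2.1 (g i).2.2

theorem abbG_mem_qsymIdeal {ε : Fin n → ℕ} (h : IsTransdiagonal ε) : abbG ε ∈ qsymIdeal n := by
  have h := abbG_mem_posSpan h
  generalize abbG ε = P at h ⊢
  induction h using Submodule.span_induction with
  | mem P h =>
    obtain ⟨μ, q, rfl, hq, h0, -⟩ := h
    exact Ideal.mul_mem_left _ _ (Ideal.subset_span ⟨hq, h0⟩)
  | zero => exact Submodule.zero_mem _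
  | add P Q _ _ hP hQ => exact Submodule.add_mem _ hP hQ
  | smul c P _ hP => rw [smul_eq_C_mul]; exact Ideal.mul_mem_left _ _ hP

theorem isGroebnerBasis_abbFamily (n : ℕ) :
    IsGroebnerBasis MonomialOrder.lex (abbFamily n) (qsymIdeal n) := by
  have hsub : abbFamily n ⊆ (qsymIdeal n : Set (MvPolynomial (Fin n) ℂ)) := by
    rintro _ ⟨ε, hε, rfl⟩
    exact abbG_mem_qsymIdeal hε
  refine ⟨hsub, le_antisymm (Ideal.span_mono (Set.image_mono hsub)) (Ideal.span_le.2 ?_)⟩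
  rintro _ ⟨P, hP, rfl⟩
  by_cases h0 : P = 0
  · rw [h0, MonomialOrder.leadingTerm_zero]
    exact Submodule.zero_mem _
  have htrans := degree_of_mem_transSpan (mem_transSpan_of_mem_qsymIdeal hP) h0
  have hlt : MonomialOrder.lex.leadingTerm P = C (MonomialOrder.lex.leadingCoeff P) *
      MonomialOrder.lex.leadingTerm (abbG (MonomialOrder.lex.degree P)) := by
    rw [leadingTerm_abbG, C_mul_monomial, mul_one, MonomialOrder.leadingTerm]
  rw [SetLike.mem_coe, hlt]
  exact Ideal.mul_mem_left _ _ (Ideal.subset_span ⟨_, ⟨_, htrans, rfl⟩, rfl⟩)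

/-! ### The quasi-symmetrizing action and its invariants. -/

theorem card_filter_lt_orderEmbOfFin (B : Finset (Fin n)) {l : ℕ} (h : B.card = l) (i : Fin l) :
    (B.filter (· < B.orderEmbOfFin h i)).card = i := by
  have : B.filter (· < B.orderEmbOfFin h i) =
      (Finset.Iio i).map (B.orderEmbOfFin h).toEmbedding := by
    ext j
    simp only [Finset.mem_filter, Finset.mem_map, Finset.mem_Iio]
    constructor
    · rintro ⟨hj, hlt⟩
      have hr : j ∈ Set.range (B.orderEmbOfFin h) := by rwa [Finset.range_orderEmbOfFin]
      obtain ⟨a, rfl⟩ := hr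
      exact ⟨a, (B.orderEmbOfFin h).lt_iff_lt.1 hlt, rfl⟩
    · rintro ⟨a, ha, rfl⟩
      exact ⟨B.orderEmbOfFin_mem h a, (B.orderEmbOfFin h).lt_iff_lt.2 ha⟩
  rw [this, Finset.card_map, Fin.card_Iio]

theorem orderedExponent_eq_mapDomain (B : Finset (Fin n)) (K : List ℕ) (h : B.card = K.length) :
    orderedExponent B K = (listVec K).mapDomain (B.orderEmbOfFin h) := by
  ext j
  simp only [orderedExponent, Finsupp.equivFunOnFinite_symm_apply_apply]
  by_cases hj : j ∈ B
  · have hr : j ∈ Set.range (B.orderEmbOfFin h) := by rwa [Finset.range_orderEmbOfFin]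
    obtain ⟨a, rfl⟩ := hr
    rw [if_pos hj, card_filter_lt_orderEmbOfFin,
      Finsupp.mapDomain_apply (B.orderEmbOfFin h).injective]
    simp [listVec]
  · rw [if_neg hj, Finsupp.mapDomain_of_notMem_range]
    rwa [Finset.range_orderEmbOfFin]

theorem comp_orderedExponent {B : Finset (Fin n)} {K : List ℕ} (h : B.card = K.length)
    (hK : ∀ k ∈ K, 0 < k) : comp (orderedExponent B K) = K := by
  rw [orderedExponent_eq_mapDomain B K h, comp_mapDomain, comp]
  simp only [listVec, Finsupp.coe_equivFunOnFinite_symm, List.ofFn_get]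
  rw [List.filter_eq_self]
  intro k hk
  simpa using (hK k hk).ne'

theorem support_orderedExponent {B : Finset (Fin n)} {K : List ℕ} (h : B.card = K.length)
    (hK : ∀ k ∈ K, 0 < k) : (orderedExponent B K).support = B := by
  have huniv : (listVec K).support = Finset.univ := by
    ext i
    simpa [listVec] using (hK _ (List.getElem_mem i.2)).ne'
  rw [orderedExponent_eq_mapDomain B K h,
    Finsupp.mapDomain_support_of_injective (B.orderEmbOfFin h).injective, huniv,
    Finset.image_orderEmbOfFin_univ]

theorem orderedExponent_support_comp (ν : Fin n →₀ ℕ) :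
    orderedExponent ν.support (comp ν) = ν := by
  rw [orderedExponent_eq_mapDomain _ _ (card_support_eq_length_comp ν), mapDomain_listVec_comp]

theorem exists_perm_of_mem_genSymmGroup {m : ℕ} {g : Matrix (Fin n) (Fin n) ℂ}
    (hg : g ∈ genSymmGroup n m) :
    ∃ σ : Equiv.Perm (Fin n), ∀ i j, g i j ≠ 0 ↔ j = σ i := by
  obtain ⟨h1, h2, -⟩ := hg
  choose f hf hf' using h1
  have hbij : Function.Bijective f := by
    constructor
    · intro i i' h
      exact (h2 (f i)).unique (hf i) (h ▸ hf i')
    · intro j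
      obtain ⟨i, hi, -⟩ := h2 j
      exact ⟨i, (hf' i j hi).symm⟩
  refine ⟨Equiv.ofBijective f hbij, fun i j => ⟨fun h => hf' i j h, ?_⟩⟩
  rintro rfl
  exact hf i

/-- The matrix with entry `c i` in row `i` and column `σ i`. -/
noncomputable def monomialMatrix (σ : Equiv.Perm (Fin n)) (c : Fin n → ℂ) :
    Matrix (Fin n) (Fin n) ℂ :=
  fun i j => if j = σ i then c i else 0

theorem monomialMatrix_ne_zero {σ : Equiv.Perm (Fin n)} {c : Fin n → ℂ} (hc : ∀ i, c i ≠ 0)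
    (i j : Fin n) : monomialMatrix σ c i j ≠ 0 ↔ j = σ i := by
  simp [monomialMatrix, hc]

theorem monomialMatrix_mem {m : ℕ} (σ : Equiv.Perm (Fin n)) {c : Fin n → ℂ} (hc : ∀ i, c i ≠ 0)
    (hm : ∀ i, c i ^ m = 1) : monomialMatrix σ c ∈ genSymmGroup n m := by
  refine ⟨fun i => ⟨σ i, ?_, fun j hj => ?_⟩, fun j => ⟨σ.symm j, ?_, fun i hi => ?_⟩,
    fun i j hij => ?_⟩
  · exact (monomialMatrix_ne_zero hc _ _).2 rfl
  · exact (monomialMatrix_ne_zero hc _ _).1 hj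
  · exact (monomialMatrix_ne_zero hc _ _).2 (by simp)
  · rw [(monomialMatrix_ne_zero hc _ _).1 hi, Equiv.symm_apply_apply]
  · rw [monomialMatrix, if_pos ((monomialMatrix_ne_zero hc _ _).1 hij), hm]

theorem weight_monomialMatrix (σ : Equiv.Perm (Fin n)) {c : Fin n → ℂ} (hc : ∀ i, c i ≠ 0) :
    weight (monomialMatrix σ c) = ∏ i, c i := by
  unfold weight
  refine Finset.prod_congr rfl fun i _ => ?_
  rw [Finset.prod_eq_single (σ i)]
  · rw [if_pos ((monomialMatrix_ne_zero hc _ _).2 rfl), monomialMatrix, if_pos rfl]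
  · intro j _ hj
    rw [if_neg fun h => hj ((monomialMatrix_ne_zero hc _ _).1 h)]
  · intro h
    exact absurd (Finset.mem_univ _) h

theorem imageAlphabet_eq_image {g : Matrix (Fin n) (Fin n) ℂ} {σ : Equiv.Perm (Fin n)}
    (hσ : ∀ i j, g i j ≠ 0 ↔ j = σ i) (A : Finset (Fin n)) : imageAlphabet g A = A.image σ := by
  ext j
  simp [imageAlphabet, hσ, eq_comm]

/-- The action of a permutation on exponent vectors. -/
noncomputable def permExponent (σ : Equiv.Perm (Fin n)) (ν : Fin n →₀ ℕ) : Fin n →₀ ℕ :=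
  orderedExponent (ν.support.image σ) (comp ν)

theorem card_image_support (σ : Equiv.Perm (Fin n)) (ν : Fin n →₀ ℕ) :
    (ν.support.image σ).card = (comp ν).length := by
  rw [Finset.card_image_of_injective _ σ.injective, card_support_eq_length_comp]

theorem comp_permExponent (σ : Equiv.Perm (Fin n)) (ν : Fin n →₀ ℕ) :
    comp (permExponent σ ν) = comp ν :=
  comp_orderedExponent (card_image_support σ ν) fun _ h => pos_of_mem_comp h

theorem support_permExponent (σ : Equiv.Perm (Fin n)) (ν : Fin n →₀ ℕ) :
    (permExponent σ ν).support = ν.support.image σ :=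
  support_orderedExponent (card_image_support σ ν) fun _ h => pos_of_mem_comp h

theorem permExponent_mul (σ τ : Equiv.Perm (Fin n)) (ν : Fin n →₀ ℕ) :
    permExponent σ (permExponent τ ν) = permExponent (σ * τ) ν := by
  conv_lhs => rw [permExponent]
  rw [comp_permExponent, support_permExponent, permExponent, Finset.image_image]
  rfl

theorem permExponent_one (ν : Fin n →₀ ℕ) : permExponent 1 ν = ν := by
  rw [permExponent, Equiv.Perm.coe_one, Finset.image_id, orderedExponent_support_comp]

theorem permExponent_injective (σ : Equiv.Perm (Fin n)) : Function.Injective (permExponent σ) := by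
  intro ν μ h
  rw [← permExponent_one ν, ← inv_mul_cancel σ, ← permExponent_mul, h, permExponent_mul,
    inv_mul_cancel, permExponent_one]

theorem coeff_quasiAct (m : ℕ) {g : Matrix (Fin n) (Fin n) ℂ} {σ : Equiv.Perm (Fin n)}
    (hσ : ∀ i j, g i j ≠ 0 ↔ j = σ i) (P : MvPolynomial (Fin n) ℂ) (ν : Fin n →₀ ℕ) :
    coeff (permExponent σ ν) (quasiAct m g P) =
      coeff ν P * weight g ^ weightExp m (comp ν) := by
  classical
  unfold quasiAct
  simp only [imageAlphabet_eq_image hσ]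
  rw [coeff_sum]
  simp only [coeff_monomial]
  rw [Finset.sum_eq_single ν]
  · exact if_pos rfl
  · intro μ _ hμ
    exact if_neg fun h => hμ (permExponent_injective σ h)
  · intro h
    rw [notMem_support_iff.1 h, zero_mul, ite_self]

/-- Any permutation carrying one support onto the other works, because the action re-sorts the
variables. -/
theorem exists_permExponent_eq {ν μ : Fin n →₀ ℕ} (h : comp ν = comp μ) :
    ∃ σ : Equiv.Perm (Fin n), permExponent σ ν = μ := by
  have hcard : ν.support.card = μ.support.card := by
    rw [card_support_eq_length_comp, card_support_eq_length_comp, h]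
  let e := Finset.equivOfCardEq hcard
  refine ⟨e.extendSubtype, ?_⟩
  have himg : ν.support.image e.extendSubtype = μ.support := by
    refine Finset.eq_of_subset_of_card_le (Finset.image_subset_iff.2 fun i hi => ?_) ?_
    · exact e.extendSubtype_mem i hi
    · rw [Finset.card_image_of_injective _ (Equiv.injective _), hcard]
  rw [permExponent, himg, h, orderedExponent_support_comp]

theorem weightExp_eq_zero_iff {m : ℕ} {K : List ℕ} : weightExp m K = 0 ↔ ∀ k ∈ K, m ∣ k := by
  unfold weightExp
  split_ifs with h
  · exact iff_of_true rfl h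
  · exact iff_of_false (by simp) h

theorem weightExp_eq_one_of_not {m : ℕ} {K : List ℕ} (h : ¬ ∀ k ∈ K, m ∣ k) :
    weightExp m K = 1 := by
  unfold weightExp
  rw [if_neg h]

theorem forall_dvd_comp_iff {m : ℕ} {ν : Fin n → ℕ} :
    (∀ k ∈ comp ν, m ∣ k) ↔ ∀ i, m ∣ ν i := by
  simp only [comp, List.mem_filter, List.mem_ofFn]
  constructor
  · intro h i
    by_cases hi : ν i = 0
    · rw [hi]
      exact dvd_zero m
    · exact h _ ⟨⟨i, rfl⟩, by simpa using hi⟩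
  · rintro h _ ⟨⟨i, rfl⟩, -⟩
    exact h i

/-- Permutation matrices have weight `1` and give quasi-symmetry; a diagonal matrix of weight `ζ ≠
1` fixes exponents and kills coefficients whose composition is not divisible by `m`. -/
theorem mem_QInv_iff {m : ℕ} (hm : 0 < m) {P : MvPolynomial (Fin n) ℂ} :
    P ∈ QInv n m ↔ IsQSym P ∧ ∀ ν, coeff ν P ≠ 0 → ∀ k ∈ comp ν, m ∣ k := by
  constructor
  · intro hP
    refine ⟨fun ν μ h => ?_, fun ν hν => ?_⟩
    · obtain ⟨σ, rfl⟩ := exists_permExponent_eq h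
      have hc : ∀ i : Fin n, (fun _ => 1 : Fin n → ℂ) i ≠ 0 := fun _ => one_ne_zero
      have hg := hP _ (monomialMatrix_mem σ hc fun _ => one_pow m)
      have := coeff_quasiAct m (monomialMatrix_ne_zero (σ := σ) hc) P ν
      rw [hg, weight_monomialMatrix σ hc, Finset.prod_const_one, one_pow, mul_one] at this
      exact this.symm
    · by_contra hdvd
      -- The index `i` shows that there is a variable and that `m > 1`, so that `ζ ≠ 1`.
      have hex : ∃ i : Fin n, ¬ m ∣ ν i := by
        rw [forall_dvd_comp_iff] at hdvd
        exact not_forall.1 hdvd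
      obtain ⟨i, hi⟩ := hex
      have hm1 : 1 < m := by
        rcases Nat.lt_or_ge 1 m with h | h
        · exact h
        · obtain rfl : m = 1 := by omega
          exact absurd (one_dvd _) hi
      have hζ := Complex.isPrimitiveRoot_exp m hm.ne'
      set ζ := Complex.exp (2 * Real.pi * Complex.I / m)
      let c : Fin n → ℂ := Function.update (fun _ => 1) i ζ
      have hcm : ∀ j, c j ^ m = 1 := by
        intro j
        by_cases hj : j = i
        · subst hj
          simp only [c, Function.update_self, hζ.pow_eq_one]
        · simp only [c, Function.update_of_ne hj, one_pow]
      have hc : ∀ j, c j ≠ 0 := by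
        intro j hj
        have := hcm j
        rw [hj, zero_pow hm.ne'] at this
        exact zero_ne_one this
      have hg := hP _ (monomialMatrix_mem 1 hc hcm)
      have h := coeff_quasiAct m (monomialMatrix_ne_zero (σ := 1) hc) P ν
      have hprod : ∏ j, c j = ζ := by
        rw [Finset.prod_update_of_mem (Finset.mem_univ i)]
        simp
      rw [hg, weight_monomialMatrix 1 hc, permExponent_one, weightExp_eq_one_of_not hdvd, pow_one,
        hprod] at h
      exact hζ.ne_one hm1 (mul_left_cancel₀ hν (by rw [mul_one]; exact h.symm))
  · rintro ⟨hP, hdvd⟩ g hg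
    obtain ⟨σ, hσ⟩ := exists_perm_of_mem_genSymmGroup hg
    ext μ
    obtain ⟨ν, rfl⟩ : ∃ ν, permExponent σ ν = μ :=
      ⟨permExponent σ⁻¹ μ, by rw [permExponent_mul, mul_inv_cancel, permExponent_one]⟩
    rw [coeff_quasiAct m hσ, hP _ _ (comp_permExponent σ ν)]
    by_cases h0 : coeff ν P = 0
    · rw [h0, zero_mul]
    · rw [weightExp_eq_zero_iff.2 (hdvd ν h0), pow_zero, mul_one]

theorem comp_smul {m : ℕ} (hm : 0 < m) (κ : Fin n →₀ ℕ) :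
    comp (m • κ) = (comp κ).map (m * ·) := by
  have h : (m • κ).support = κ.support := Finsupp.support_smul_eq hm.ne'
  rw [comp_eq_map_sort, comp_eq_map_sort, List.map_map, h]
  rfl

theorem exists_smul_of_forall_dvd {m : ℕ} {ν : Fin n →₀ ℕ} (h : ∀ i, m ∣ ν i) :
    ∃ κ : Fin n →₀ ℕ, ν = m • κ := by
  choose f hf using h
  exact ⟨Finsupp.equivFunOnFinite.symm f, by ext i; simp [hf i]⟩

theorem exists_expand_eq {m : ℕ} {P : MvPolynomial (Fin n) ℂ}
    (h : ∀ ν, coeff ν P ≠ 0 → ∀ i, m ∣ ν i) : ∃ Q, expand m Q = P := by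
  have : P ∈ (expand m : MvPolynomial (Fin n) ℂ →ₐ[ℂ] MvPolynomial (Fin n) ℂ).range := by
    rw [P.as_sum]
    refine Subalgebra.sum_mem _ fun ν hν => ?_
    obtain ⟨κ, rfl⟩ := exists_smul_of_forall_dvd (h ν (mem_support_iff.1 hν))
    exact ⟨monomial κ _, expand_monomial _ _ _⟩
  exact this

theorem isQSym_expand_iff {m : ℕ} (hm : 0 < m) {Q : MvPolynomial (Fin n) ℂ} :
    IsQSym (expand m Q) ↔ IsQSym Q := by
  constructor
  · intro h ν μ hc
    rw [← coeff_expand_smul m hm.ne' Q ν, ← coeff_expand_smul m hm.ne' Q μ]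
    exact h _ _ (by rw [comp_smul hm, comp_smul hm, hc])
  · intro h ν μ hc
    by_cases hd : ∀ k ∈ comp ν, m ∣ k
    · obtain ⟨κ, rfl⟩ := exists_smul_of_forall_dvd (forall_dvd_comp_iff.1 hd)
      obtain ⟨κ', rfl⟩ := exists_smul_of_forall_dvd (forall_dvd_comp_iff.1 (hc ▸ hd))
      rw [coeff_expand_smul m hm.ne', coeff_expand_smul m hm.ne']
      refine h _ _ ?_
      rw [comp_smul hm, comp_smul hm] at hc
      exact List.map_injective_iff.2 (fun a b hab => Nat.eq_of_mul_eq_mul_left hm hab) hc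
    · have h1 := hd
      have h2 := hc ▸ hd
      rw [forall_dvd_comp_iff, not_forall] at h1 h2
      obtain ⟨i, hi⟩ := h1
      obtain ⟨j, hj⟩ := h2
      rw [coeff_expand_of_not_dvd Q hi, coeff_expand_of_not_dvd Q hj]

theorem QInv_eq_image {m : ℕ} (hm : 0 < m) :
    QInv n m = (fun Q => expand m Q) '' {Q : MvPolynomial (Fin n) ℂ | IsQSym Q} := by
  ext P
  rw [mem_QInv_iff hm]
  constructor
  · rintro ⟨h1, h2⟩
    obtain ⟨Q, rfl⟩ := exists_expand_eq fun ν hν => forall_dvd_comp_iff.1 (h2 ν hν)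
    exact ⟨Q, (isQSym_expand_iff hm).1 h1, rfl⟩
  · rintro ⟨Q, hQ, rfl⟩
    refine ⟨(isQSym_expand_iff hm).2 hQ, fun ν hν => ?_⟩
    rw [forall_dvd_comp_iff]
    by_contra hc
    obtain ⟨i, hi⟩ := not_forall.1 hc
    exact hν (coeff_expand_of_not_dvd Q hi)

theorem quasiIdeal_eq_map {m : ℕ} (hm : 0 < m) :
    quasiIdeal n m =
      (qsymIdeal n).map (expand m : MvPolynomial (Fin n) ℂ →ₐ[ℂ] MvPolynomial (Fin n) ℂ) := by
  rw [quasiIdeal, qsymIdeal, Ideal.map_span, QInv_eq_image hm]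
  congr 1
  ext P
  constructor
  · rintro ⟨⟨Q, hQ, rfl⟩, h0⟩
    exact ⟨Q, ⟨hQ, (coeff_expand_zero m hm.ne' Q).symm.trans h0⟩, rfl⟩
  · rintro ⟨Q, ⟨hQ, h0⟩, rfl⟩
    exact ⟨⟨Q, hQ, rfl⟩, (coeff_expand_zero m hm.ne' Q).trans h0⟩

theorem quasiIdeal_one : quasiIdeal n 1 = qsymIdeal n := by
  rw [quasiIdeal_eq_map one_pos, expand_one]
  exact Ideal.map_id _

/-! ### Gröbner bases and the substitution of `m`-th powers. -/

section Expand

variable {σ k : Type*} [Field k] {ord : MonomialOrder σ} {m : ℕ}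

theorem coeff_expand_of_lt_of_ne_zero (P : MvPolynomial σ k) {r : σ →₀ ℕ} (hr : ∀ i, r i < m)
    (h0 : r ≠ 0) (κ : σ →₀ ℕ) : coeff (m • κ + r) (expand m P) = 0 := by
  obtain ⟨i, hi⟩ := Finsupp.ne_iff.1 h0
  refine coeff_expand_of_not_dvd P (i := i) fun hd => ?_
  have : m ∣ r i := (Nat.dvd_add_right (dvd_mul_right m (κ i))).1 (by simpa using hd)
  exact absurd (Nat.le_of_dvd (Nat.pos_of_ne_zero hi) this) (hr i).not_ge

/-- The condition that the components of `P` over the subring of the polynomials in the `m`-th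
powers of the variables lie in `I`. -/
def HasComponentsIn (m : ℕ) (I : Ideal (MvPolynomial σ k)) (P : MvPolynomial σ k) : Prop :=
  ∀ r : σ →₀ ℕ, (∀ i, r i < m) → ∃ Q ∈ I, ∀ κ, coeff κ Q = coeff (m • κ + r) P

theorem HasComponentsIn.add {I : Ideal (MvPolynomial σ k)} {P P' : MvPolynomial σ k}
    (h : HasComponentsIn m I P) (h' : HasComponentsIn m I P') : HasComponentsIn m I (P + P') := by
  intro r hr
  obtain ⟨Q, hQ, hc⟩ := h r hr
  obtain ⟨Q', hQ', hc'⟩ := h' r hr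
  exact ⟨Q + Q', I.add_mem hQ hQ', fun κ => by rw [coeff_add, coeff_add, hc, hc']⟩

/-- Multiplication by `x_i` raises the residue `r i` by one; when it wraps from `m - 1` to `0`, the
component picks up a factor `x_i`. -/
theorem HasComponentsIn.X_mul (hm : 0 < m) {I : Ideal (MvPolynomial σ k)} {P : MvPolynomial σ k}
    (h : HasComponentsIn m I P) (i : σ) : HasComponentsIn m I (X i * P) := by
  classical
  intro r hr
  by_cases hi : r i = 0
  · obtain ⟨Q, hQ, hc⟩ := h (r + Finsupp.single i (m - 1)) (fun j => by
      by_cases hj : i = j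
      · subst hj
        simp only [Finsupp.add_apply, hi, Finsupp.single_eq_same]
        omega
      · simpa [Finsupp.single_apply, hj] using hr j)
    refine ⟨X i * Q, I.mul_mem_left _ hQ, fun κ => ?_⟩
    rw [coeff_X_mul', coeff_X_mul']
    by_cases hκ : κ i = 0
    · rw [if_neg (by simpa using hκ), if_neg (by simp [hκ, hi])]
    · rw [if_pos (by simpa using hκ), if_pos (by simp [hκ, hm.ne']), hc]
      congr 1
      ext j
      by_cases hj : i = j
      · subst hj
        obtain ⟨a, ha⟩ := Nat.exists_eq_succ_of_ne_zero hκ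
        simp [ha, hi, Nat.mul_succ]
        omega
      · simp [hj]
  · obtain ⟨Q, hQ, hc⟩ := h (r - Finsupp.single i 1) (fun j =>
      lt_of_le_of_lt (by simp) (hr j))
    refine ⟨Q, hQ, fun κ => ?_⟩
    rw [coeff_X_mul', if_pos (by simp [hi]), hc]
    congr 1
    ext j
    by_cases hj : i = j
    · subst hj
      simp
      omega
    · simp [hj]

theorem hasComponentsIn_of_mem_map (hm : 0 < m) {I : Ideal (MvPolynomial σ k)}
    {P : MvPolynomial σ k}
    (hP : P ∈ I.map (expand m : MvPolynomial σ k →ₐ[k] MvPolynomial σ k)) :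
    HasComponentsIn m I P := by
  rw [Ideal.map] at hP
  induction hP using Submodule.span_induction with
  | mem P h =>
    obtain ⟨p, hp, rfl⟩ := h
    intro r hr
    by_cases h0 : r = 0
    · subst h0
      exact ⟨p, hp, fun κ => by rw [add_zero]; exact (coeff_expand_smul m hm.ne' p κ).symm⟩
    · exact ⟨0, I.zero_mem, fun κ =>
        (coeff_zero κ).trans (coeff_expand_of_lt_of_ne_zero p hr h0 κ).symm⟩
  | zero => exact fun r _ => ⟨0, I.zero_mem, fun κ => by rw [coeff_zero, coeff_zero]⟩
  | add P P' _ _ hP hP' => exact hP.add hP'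
  | smul f P _ hP =>
    rw [smul_eq_mul]
    induction f using MvPolynomial.induction_on with
    | C a =>
      intro r hr
      obtain ⟨Q, hQ, hc⟩ := hP r hr
      exact ⟨C a * Q, I.mul_mem_left _ hQ, fun κ => by rw [coeff_C_mul, coeff_C_mul, hc]⟩
    | add f g hf hg => rw [add_mul]; exact hf.add hg
    | mul_X f i hf => rw [mul_comm f, mul_assoc]; exact hf.X_mul hm i

theorem exists_eq_smul_add (hm : 0 < m) (ν : σ →₀ ℕ) :
    ∃ κ r : σ →₀ ℕ, ν = m • κ + r ∧ ∀ i, r i < m := by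
  refine ⟨ν.mapRange (· / m) (Nat.zero_div m), ν.mapRange (· % m) (Nat.zero_mod m), ?_, fun i => ?_⟩
  · ext i
    simp [Nat.div_add_mod]
  · simpa using Nat.mod_lt _ hm

theorem toSyn_smul_lt_smul (hm : 0 < m) {κ κ' : σ →₀ ℕ} (h : ord.toSyn κ < ord.toSyn κ') :
    ord.toSyn (m • κ) < ord.toSyn (m • κ') := by
  rw [map_nsmul, map_nsmul]
  exact nsmul_lt_nsmul_right hm.ne' h

theorem toSyn_le_of_smul_add_le (hm : 0 < m) {κ κ' r : σ →₀ ℕ}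
    (h : ord.toSyn (m • κ + r) ≤ ord.toSyn (m • κ' + r)) : ord.toSyn κ ≤ ord.toSyn κ' := by
  by_contra hlt
  have := toSyn_smul_lt_smul (ord := ord) hm (not_le.1 hlt)
  rw [map_add, map_add, add_le_add_iff_right] at h
  exact this.not_ge h

theorem degree_eq_of_forall_coeff (hm : 0 < m) {P Q : MvPolynomial σ k} {κ r : σ →₀ ℕ}
    (hP : P ≠ 0) (hd : ord.degree P = m • κ + r)
    (hc : ∀ κ, coeff κ Q = coeff (m • κ + r) P) : ord.degree Q = κ := by
  apply ord.toSyn.injective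
  apply le_antisymm
  · rw [MonomialOrder.degree_le_iff]
    intro μ hμ
    rw [mem_support_iff, hc] at hμ
    apply toSyn_le_of_smul_add_le hm (r := r)
    rw [← hd]
    exact ord.le_degree (mem_support_iff.2 hμ)
  · apply ord.le_degree
    rw [mem_support_iff, hc, ← hd]
    exact ord.coeff_degree_ne_zero_iff.2 hP

theorem leadingTerm_expand (hm : 0 < m) (P : MvPolynomial σ k) :
    ord.leadingTerm (expand m P) = expand m (ord.leadingTerm P) := by
  by_cases h0 : P = 0
  · rw [h0, map_zero, MonomialOrder.leadingTerm_zero, map_zero]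
  have hE : expand m P ≠ 0 := (expand_ne_zero hm).2 h0
  have hd : ord.degree (expand m P) = m • ord.degree P := by
    apply ord.toSyn.injective
    apply le_antisymm
    · rw [MonomialOrder.degree_le_iff]
      classical
      intro μ hμ
      rw [support_expand P hm.ne'] at hμ
      obtain ⟨κ, hκ, rfl⟩ := Finset.mem_image.1 hμ
      rw [map_nsmul, map_nsmul]
      exact nsmul_le_nsmul_right (ord.le_degree hκ) m
    · apply ord.le_degree
      rw [mem_support_iff, coeff_expand_smul m hm.ne']
      exact ord.coeff_degree_ne_zero_iff.2 h0
  rw [MonomialOrder.leadingTerm, MonomialOrder.leadingTerm, expand_monomial,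
    MonomialOrder.leadingCoeff, hd, coeff_expand_smul m hm.ne', MonomialOrder.leadingCoeff]

/-- If `P` has leading exponent `m • κ + r` with `r` reduced, its component `Q` at `r` lies in `I`
and has leading exponent `κ`. Hence the leading term of `P` is `X^r` times the expansion of that of
`Q`, which `S` controls. -/
theorem IsGroebnerBasis.image_expand (hm : 0 < m) {S : Set (MvPolynomial σ k)}
    {I : Ideal (MvPolynomial σ k)} (h : IsGroebnerBasis ord S I) :
    IsGroebnerBasis ord ((fun P => expand m P) '' S)
      (I.map (expand m : MvPolynomial σ k →ₐ[k] MvPolynomial σ k)) := by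
  have hsub : (fun P => expand m P) '' S ⊆
      (I.map (expand m : MvPolynomial σ k →ₐ[k] MvPolynomial σ k) : Set (MvPolynomial σ k)) := by
    rintro _ ⟨P, hP, rfl⟩
    exact Ideal.mem_map_of_mem _ (h.1 hP)
  refine ⟨hsub, le_antisymm (Ideal.span_mono (Set.image_mono hsub)) (Ideal.span_le.2 ?_)⟩
  rintro _ ⟨P, hP, rfl⟩
  by_cases h0 : P = 0
  · rw [h0, MonomialOrder.leadingTerm_zero]
    exact Submodule.zero_mem _
  obtain ⟨κ, r, hd, hr⟩ := exists_eq_smul_add hm (ord.degree P)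
  obtain ⟨Q, hQ, hc⟩ := hasComponentsIn_of_mem_map hm hP r hr
  have hdQ := degree_eq_of_forall_coeff hm h0 hd hc
  have hlt : ord.leadingTerm P = monomial r 1 * expand m (ord.leadingTerm Q) := by
    rw [MonomialOrder.leadingTerm, MonomialOrder.leadingTerm, expand_monomial, monomial_mul,
      MonomialOrder.leadingCoeff, MonomialOrder.leadingCoeff, hdQ, hc, hd, one_mul, add_comm r]
  have hQmem : ord.leadingTerm Q ∈ Ideal.span (ord.leadingTerm '' S) := by
    rw [h.2]
    exact Ideal.subset_span ⟨Q, hQ, rfl⟩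
  rw [SetLike.mem_coe, hlt]
  refine Ideal.mul_mem_left _ _ ?_
  have hmem := Ideal.mem_map_of_mem
    (expand m : MvPolynomial σ k →ₐ[k] MvPolynomial σ k) hQmem
  rw [Ideal.map_span] at hmem
  refine Ideal.span_mono ?_ hmem
  rintro _ ⟨_, ⟨p, hp, rfl⟩, rfl⟩
  exact ⟨_, ⟨p, hp, rfl⟩, leadingTerm_expand hm p⟩

end Expand

end QuasiInv

theorem mainTheorem3 (n m : ℕ) (hm : 0 < m) :
    QuasiInv.IsGroebnerBasis MonomialOrder.lex
        (QuasiInv.powSet m (QuasiInv.abbFamily n)) (QuasiInv.quasiIdeal n m) ∧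
      ∀ S : Set (MvPolynomial (Fin n) ℂ),
        QuasiInv.IsGroebnerBasis MonomialOrder.lex S (QuasiInv.quasiIdeal n 1) →
        QuasiInv.IsGroebnerBasis MonomialOrder.lex
          (QuasiInv.powSet m S) (QuasiInv.quasiIdeal n m) := by
  rw [QuasiInv.quasiIdeal_eq_map hm, QuasiInv.quasiIdeal_one]
  exact ⟨(QuasiInv.isGroebnerBasis_abbFamily n).image_expand hm, fun S hS => hS.image_expand hm⟩
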